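/- Let $K\subset\mathbb{E}^3$ be a compact convex set with mean curvature integral $M$, surface area $F$ and volume $V$. Then $$\frac{\pi}{2}\,M F-2\pi^2 V=\int_{P\notin K}\alpha(\Omega(P))\,dP,$$ the integral on the right being (absolutely) convergent. Here $M$ and $F$ are the coefficients in Steiner's formula $V(K_\rho)=V+F\rho+M\rho^2+\frac{4\pi}{3}\rho^3$ ($\rho>0$, $K\neq\emptyset$), where $K_\rho$ is the set of points at distance at most $\rho$ from $K$; that is, $$F=\lim_{\rho\to0^+}\frac{V(K_\rho)-V}{\rho},\qquad M=\lim_{\rho\to0^+}\frac{V(K_\rho)-V-F\rho}{\rho^2},$$ and these limits exist. (If $\partial K$ is smooth, $F$ is its area and $M$ is the integral over it of the mean curvature $\frac12(k_1+k_2)$; a flat set is counted with both its sides.) For $P\notin K$, the visual solid angle $\Omega(P)\subset S^2$ is the set of unit vectors $u$ such that the ray $\{P+tu:\ t\ge 0\}$ meets $K$. For $\Omega\subset S^2$, $\tilde\Omega$ is the set of unit vectors $v$ whose orthogonal plane $v^{\perp}$ meets $\Omega$, and $$\alpha(\Omega)=\frac12\int_{u\in\Omega,\ v\in\tilde\Omega}|\langle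 u,v\rangle|\,du\,dv,$$ where $du$, $dv$ denote the surface (Lebesgue) measure on the unit sphere $S^2$, and $dP$ is Lebesgue measure. -/

import Mathlib

open MeasureTheory Metric Set Filter Topology

/-- Euclidean three-space. -/
abbrev E3 : Type := EuclideanSpace ℝ (Fin 3)

/-- The unit sphere of Euclidean three-space. -/
abbrev S2 : Type := sphere (0 : E3) 1

/-- The surface (Lebesgue) measure of the unit sphere, of total mass `4π`. -/
noncomputable abbrev sphereMeasure : Measure S2 := (volume : Measure E3).toSphere

/-- The volume of the outer parallel body of `K` at distance `ρ`, that is, of the set of points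
at distance at most `ρ` from `K`. -/
noncomputable def parallelVolume (K : Set E3) (ρ : ℝ) : ℝ :=
  (volume : Measure E3).real (cthickening ρ K)

/-- The difference quotient whose limit as `ρ → 0+` is the surface area. -/
noncomputable def areaQuotient (K : Set E3) (ρ : ℝ) : ℝ :=
  (parallelVolume K ρ - (volume : Measure E3).real K) / ρ

/-- The surface area of a convex body, in Minkowski's sense:
the first Steiner coefficient `F = lim (V(K_ρ) - V(K)) / ρ` as `ρ → 0+`.
(A flat body is counted with both of its sides.) -/
noncomputable def surfaceArea (K : Set E3) : ℝ :=
  limUnder (𝓝[>] (0 : ℝ)) (areaQuotient K)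

/-- The second order quotient whose limit as `ρ → 0+` is the mean curvature integral. -/
noncomputable def meanCurvatureQuotient (K : Set E3) (ρ : ℝ) : ℝ :=
  (parallelVolume K ρ - (volume : Measure E3).real K - surfaceArea K * ρ) / ρ ^ 2

/-- The mean curvature integral of a convex body: the second Steiner coefficient
`M = lim (V(K_ρ) - V(K) - F ρ) / ρ ^ 2` as `ρ → 0+`, so that
`V(K_ρ) = V + F ρ + M ρ ^ 2 + (4 π / 3) ρ ^ 3`. If the boundary is a smooth surface this is the
integral over it of the mean curvature `(k₁ + k₂) / 2`; for a ball of radius `R` it is `4 π R`. -/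
noncomputable def meanCurvatureIntegral (K : Set E3) : ℝ :=
  limUnder (𝓝[>] (0 : ℝ)) (meanCurvatureQuotient K)

/-- The visual solid angle `Ω(P)` of `K` from `P`: the unit directions `u` such that the ray
`P + t u`, `t ≥ 0`, meets `K`. -/
def solidAngle (K : Set E3) (P : E3) : Set S2 :=
  {u | ∃ t : ℝ, 0 ≤ t ∧ P + t • (u : E3) ∈ K}

/-- `Ω̃`: the unit directions `v` whose orthogonal plane `v^⊥` meets `Ω`. -/
def normalsMeeting (Ω : Set S2) : Set S2 :=
  {v | ∃ u ∈ Ω, inner ℝ (u : E3) (v : E3) = 0}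

/-- `α(Ω) = ½ ∫_{u ∈ Ω, v ∈ Ω̃} |⟨u, v⟩| du dv`. -/
noncomputable def alpha (Ω : Set S2) : ℝ :=
  (1 / 2) * ∫ p in Ω ×ˢ normalsMeeting Ω, |inner ℝ (p.1 : E3) (p.2 : E3)|
    ∂(sphereMeasure.prod sphereMeasure)

/-! Weigh each triple (P, u, v) by |⟨u, v⟩| when the line through P with direction u and the plane
through P with normal v both meet K, and compute the total weight in two ways.

For fixed P: if P ∈ K, every line and plane qualifies, giving 4π · 2π = 8π². If P ∉ K, the
qualifying lines are the solid angle and its disjoint antipode, and the qualifying normals form Ω̃,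
giving 4 α(Ω(P)).

For fixed (u, v) with ⟨u, v⟩ ≠ 0: the points P fill a slab of a cylinder. Its volume is the
projection area b(u) times the width w(v), divided by |⟨u, v⟩|, so the weight cancels the
obliqueness. By Fubini the total is (∫ b)(∫ w) = (πF)(2M). Hence 2πMF = 8π²V + 4 ∫ α; its finiteness
also yields convergence (`exists_projection_content`, `lintegral_pairContent`).

It remains to identify ∫ b and ∫ w with the Steiner coefficients. A segment adds to the volume
linearly in its length, so the volume of K + ρZ is a polynomial in ρ for a sum Z of segments, of
degree at most 3 by growth. Since ∫ |⟨u, y⟩| du = 2π‖y‖, the unit ball is a limit of such Z. Passing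
to the limit gives a Steiner cubic whose linear coefficient is Cauchy's integral of b
(`exists_steiner_cubic`). Its two top coefficients are read off as ρ → ∞: in direction u, the set K
+ ρB has radial extent ρ + h(u) + O(1/ρ), with h the support function
(`exists_abs_volume_add_closedBall_sub_le`), so M = ∫ h. -/

open scoped Pointwise

/-! ### Support functions and continuity of volume -/

section SupportFunction

variable {E : Type*} [NormedAddCommGroup E] [InnerProductSpace ℝ E]

/-- The support function of a set. -/
noncomputable def supportFn (K : Set E) (y : E) : ℝ := sSup ((fun p => inner ℝ p y) '' K)

/-- The symmetric segment from `-x` to `x`. -/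
def symmSegment (x : E) : Set E := segment ℝ (-x) x

theorem exists_inner_eq_supportFn {K : Set E} (hK : IsCompact K) (hne : K.Nonempty) (y : E) :
    ∃ p ∈ K, inner ℝ p y = supportFn K y := by
  obtain ⟨p, hp, h⟩ := hK.exists_sSup_image_eq hne
    (f := fun p => inner ℝ p y) (by fun_prop)
  exact ⟨p, hp, h.symm⟩

theorem inner_le_supportFn {K : Set E} (hK : IsCompact K) {p : E} (hp : p ∈ K) (y : E) :
    inner ℝ p y ≤ supportFn K y :=
  le_csSup (hK.image (f := fun p => inner ℝ p y) (by fun_prop)).bddAbove (mem_image_of_mem _ hp)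

theorem supportFn_eq_of_le_of_mem {K : Set E} {y p : E} (hp : p ∈ K)
    (h : ∀ q ∈ K, inner ℝ q y ≤ inner ℝ p y) : supportFn K y = inner ℝ p y :=
  IsGreatest.csSup_eq ⟨mem_image_of_mem _ hp, by rintro _ ⟨q, hq, rfl⟩; exact h q hq⟩

theorem supportFn_add {K L : Set E} (hK : IsCompact K) (hL : IsCompact L) (hKn : K.Nonempty)
    (hLn : L.Nonempty) (y : E) : supportFn (K + L) y = supportFn K y + supportFn L y := by
  obtain ⟨p, hp, hp'⟩ := exists_inner_eq_supportFn hK hKn y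
  obtain ⟨q, hq, hq'⟩ := exists_inner_eq_supportFn hL hLn y
  rw [supportFn_eq_of_le_of_mem (add_mem_add hp hq), inner_add_left, hp', hq']
  rintro _ ⟨a, ha, b, hb, rfl⟩
  simp only [inner_add_left, hp', hq']
  exact add_le_add (inner_le_supportFn hK ha y) (inner_le_supportFn hL hb y)

theorem mem_symmSegment {x p : E} : p ∈ symmSegment x ↔ ∃ t : ℝ, |t| ≤ 1 ∧ p = t • x := by
  rw [symmSegment, segment_eq_image]
  constructor
  · rintro ⟨θ, hθ, rfl⟩
    refine ⟨2 * θ - 1, abs_le.2 ⟨by linarith [hθ.1], by linarith [hθ.2]⟩, ?_⟩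
    simp only [smul_neg]
    module
  · rintro ⟨t, ht, rfl⟩
    rw [abs_le] at ht
    refine ⟨(t + 1) / 2, ⟨by linarith, by linarith⟩, ?_⟩
    simp only [smul_neg]
    module

theorem isCompact_symmSegment (x : E) : IsCompact (symmSegment x) := by
  rw [symmSegment, segment_eq_image]
  exact isCompact_Icc.image (by fun_prop)

theorem convex_symmSegment (x : E) : Convex ℝ (symmSegment x) := convex_segment _ _

theorem nonempty_symmSegment (x : E) : (symmSegment x).Nonempty := ⟨x, right_mem_segment ℝ _ _⟩

theorem supportFn_symmSegment (x y : E) : supportFn (symmSegment x) y = |inner ℝ x y| := by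
  have key : ∀ q ∈ symmSegment x, inner ℝ q y ≤ |inner ℝ x y| := by
    intro q hq
    obtain ⟨t, ht, rfl⟩ := mem_symmSegment.1 hq
    rw [inner_smul_left]
    calc t * inner ℝ x y ≤ |t * inner ℝ x y| := le_abs_self _
      _ = |t| * |inner ℝ x y| := abs_mul _ _
      _ ≤ 1 * |inner ℝ x y| := by gcongr
      _ = _ := one_mul _
  rcases le_total 0 (inner ℝ x y) with h | h
  · rw [abs_of_nonneg h] at key ⊢
    exact supportFn_eq_of_le_of_mem (right_mem_segment ℝ _ _) key
  · rw [abs_of_nonpos h, ← inner_neg_left] at key ⊢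
    exact supportFn_eq_of_le_of_mem (left_mem_segment ℝ _ _) key

theorem supportFn_closedBall {ρ : ℝ} (hρ : 0 ≤ ρ) (y : E) :
    supportFn (closedBall (0 : E) ρ) y = ρ * ‖y‖ := by
  have key : ∀ q ∈ closedBall (0 : E) ρ, inner ℝ q y ≤ ρ * ‖y‖ := by
    intro q hq
    exact (real_inner_le_norm q y).trans (by gcongr; simpa using hq)
  rcases eq_or_ne y 0 with rfl | hy
  · rw [supportFn_eq_of_le_of_mem (mem_closedBall_self hρ) (by simp)]
    simp
  · have hy' : ‖y‖ ≠ 0 := norm_ne_zero_iff.2 hy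
    have hin : inner ℝ ((ρ / ‖y‖) • y) y = ρ * ‖y‖ := by
      rw [inner_smul_left, real_inner_self_eq_norm_sq]
      simp only [conj_trivial]
      field_simp
    rw [← hin] at key ⊢
    refine supportFn_eq_of_le_of_mem ?_ key
    simp [norm_smul, hy', abs_of_nonneg hρ]

/-- Otherwise a separating functional, represented by a vector through Riesz, violates the bound. -/
theorem mem_of_forall_inner_le [CompleteSpace E] {K : Set E} (hK : IsCompact K)
    (hc : Convex ℝ K) {p : E}
    (h : ∀ y, inner ℝ p y ≤ supportFn K y) (hne : K.Nonempty) : p ∈ K := by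
  by_contra hp
  obtain ⟨f, u, hu, hfp⟩ := geometric_hahn_banach_closed_point hc hK.isClosed hp
  obtain ⟨q, hq, hq'⟩ := exists_inner_eq_supportFn hK hne ((InnerProductSpace.toDual ℝ E).symm f)
  have h1 := h ((InnerProductSpace.toDual ℝ E).symm f)
  rw [← hq', real_inner_comm, InnerProductSpace.toDual_symm_apply, real_inner_comm,
    InnerProductSpace.toDual_symm_apply] at h1
  linarith [hu q hq]

theorem supportFn_le_add_mul {K : Set E} (hK : IsCompact K) (hne : K.Nonempty) {R : ℝ}
    (hR : ∀ p ∈ K, ‖p‖ ≤ R) (y z : E) : supportFn K y ≤ supportFn K z + R * ‖y - z‖ := by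
  obtain ⟨p, hp, hp'⟩ := exists_inner_eq_supportFn hK hne y
  have h1 := inner_le_supportFn hK hp z
  have h2 : inner ℝ p (y - z) ≤ R * ‖y - z‖ :=
    (real_inner_le_norm _ _).trans (by gcongr; exact hR p hp)
  rw [inner_sub_right] at h2
  linarith

theorem abs_supportFn_le {K : Set E} (hK : IsCompact K) (hne : K.Nonempty) {R : ℝ}
    (hR : ∀ p ∈ K, ‖p‖ ≤ R) (y : E) : |supportFn K y| ≤ R * ‖y‖ := by
  obtain ⟨p, hp, hp'⟩ := exists_inner_eq_supportFn hK hne y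
  rw [← hp']
  exact (abs_real_inner_le_norm _ _).trans (by gcongr; exact hR p hp)

theorem continuous_supportFn {K : Set E} (hK : IsCompact K) (hne : K.Nonempty) :
    Continuous (supportFn K) := by
  obtain ⟨R, hR, h⟩ := hK.isBounded.exists_pos_norm_le
  refine (LipschitzWith.of_le_add_mul ⟨R, hR.le⟩ fun y z => ?_).continuous
  rw [dist_eq_norm]
  exact supportFn_le_add_mul hK hne h y z

theorem add_mul_norm_le_supportFn {K : Set E} (hK : IsCompact K) {p : E} {δ : ℝ} (hδ : 0 ≤ δ)
    (h : closedBall p δ ⊆ K) (y : E) : inner ℝ p y + δ * ‖y‖ ≤ supportFn K y := by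
  rcases eq_or_ne y 0 with rfl | hy
  · simpa using inner_le_supportFn hK (h (mem_closedBall_self hδ)) 0
  have hy' : ‖y‖ ≠ 0 := norm_ne_zero_iff.2 hy
  have hmem : p + (δ / ‖y‖) • y ∈ K := h <| by
    simp [norm_smul, hy', abs_of_nonneg hδ]
  have := inner_le_supportFn hK hmem y
  rw [inner_add_left, inner_smul_left, real_inner_self_eq_norm_sq] at this
  simp only [conj_trivial] at this
  convert this using 2
  field_simp

variable [FiniteDimensional ℝ E] [MeasurableSpace E] [BorelSpace E]
  (μ : Measure E) [μ.IsAddHaarMeasure]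

/-- The volume of convex bodies depends continuously on the support function. -/
theorem tendsto_measureReal_of_tendsto_supportFn {ι : Type*} {l : Filter ι} [l.IsCountablyGenerated]
    {C : ι → Set E} {D : Set E} {ε : ι → ℝ} (hC : ∀ i, IsCompact (C i))
    (hCc : ∀ i, Convex ℝ (C i)) (hCn : ∀ i, (C i).Nonempty) (hD : IsCompact D) (hDc : Convex ℝ D)
    (hDn : D.Nonempty) (hε : Tendsto ε l (𝓝 0))
    (h : ∀ i y, |supportFn (C i) y - supportFn D y| ≤ ε i * ‖y‖) :
    Tendsto (fun i => μ.real (C i)) l (𝓝 (μ.real D)) := by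
  have : CompleteSpace E := FiniteDimensional.complete ℝ E
  obtain ⟨R, hR, hDR⟩ := hD.isBounded.exists_pos_norm_le
  -- Testing the support functions at y = p gives ‖p‖² ≤ (R + ε)‖p‖.
  have hbd : ∀ᶠ i in l, ∀ p ∈ C i, ‖p‖ ≤ R + 1 := by
    filter_upwards [hε.eventually_lt_const one_pos] with i hi p hp
    have h1 := inner_le_supportFn (hC i) hp p
    have h2 := abs_le.1 (h i p)
    have h3 := abs_le.1 (abs_supportFn_le hD hDn hDR p)
    rw [real_inner_self_eq_norm_sq] at h1
    by_contra! hlt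
    have : ε i * ‖p‖ ≤ 1 * ‖p‖ := by gcongr
    nlinarith [norm_nonneg p]
  have key : Tendsto (fun i => ∫ p, (C i).indicator (fun _ => (1 : ℝ)) p ∂μ) l
      (𝓝 (∫ p, D.indicator (fun _ => (1 : ℝ)) p ∂μ)) := by
    refine tendsto_integral_filter_of_dominated_convergence
      ((closedBall (0 : E) (R + 1)).indicator fun _ => (1 : ℝ)) ?_ ?_ ?_ ?_
    · exact Eventually.of_forall fun i =>
        (measurable_const.indicator (hC i).measurableSet).aestronglyMeasurable
    · filter_upwards [hbd] with i hi
      refine ae_of_all _ fun p => ?_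
      rw [norm_indicator_eq_indicator_norm]
      simp only [norm_one]
      exact indicator_le_indicator_of_subset (fun p hp => by simpa using hi p hp)
        (fun _ => zero_le_one) p
    · exact (integrable_indicator_iff measurableSet_closedBall).2
        (integrableOn_const measure_closedBall_lt_top.ne)
    -- The frontier of a convex set is null. An interior point has a margin δ in all directions, and
    -- an outside point is strictly cut off in one direction; both survive a small change of the
    -- support function.
    · have hfr : ∀ᵐ p ∂μ, p ∉ frontier D := measure_eq_zero_iff_ae_notMem.1 (hDc.addHaar_frontier μ)
      filter_upwards [hfr] with p hp
      by_cases hpD : p ∈ D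
      · have hint : p ∈ interior D := by
          by_contra hcon
          exact hp ⟨subset_closure hpD, hcon⟩
        obtain ⟨δ, hδ, hball⟩ := nhds_basis_closedBall.mem_iff.1 (mem_interior_iff_mem_nhds.1 hint)
        refine tendsto_const_nhds.congr' ?_
        filter_upwards [hε.eventually_lt_const hδ] with i hi
        have : p ∈ C i := mem_of_forall_inner_le (hC i) (hCc i) (fun y => by
          have h1 := add_mul_norm_le_supportFn hD hδ.le hball y
          have h2 := abs_le.1 (h i y)
          have h3 : ε i * ‖y‖ ≤ δ * ‖y‖ := by gcongr
          linarith) (hCn i)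
        rw [indicator_of_mem this, indicator_of_mem hpD]
      · obtain ⟨y, hy⟩ : ∃ y, supportFn D y < inner ℝ p y := by
          by_contra! hcon
          exact hpD (mem_of_forall_inner_le hD hDc hcon hDn)
        refine tendsto_const_nhds.congr' ?_
        have h0 : Tendsto (fun i => ε i * ‖y‖) l (𝓝 0) := by simpa using hε.mul_const ‖y‖
        filter_upwards [h0.eventually_lt_const (sub_pos.2 hy)] with i hi
        have : p ∉ C i := fun hpi => by
          have h1 := inner_le_supportFn (hC i) hpi y
          have h2 := abs_le.1 (h i y)
          linarith
        rw [indicator_of_notMem this, indicator_of_notMem hpD]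
  simpa [integral_indicator_const, (hC _).measurableSet, hD.measurableSet] using key

end SupportFunction

/-! ### Adding a segment, fibre by fibre -/

section Cylinder

variable {F : Type*} [NormedAddCommGroup F] [NormedSpace ℝ F]
  [MeasurableSpace F] [BorelSpace F] [SecondCountableTopology F]

/-- Fibrewise (Cavalieri) computation of the volume gained by adding a segment. -/
theorem prod_measure_add_segment (ν : Measure F) [SFinite ν] {K L : Set (ℝ × F)} (hK : IsCompact K)
    (hKc : Convex ℝ K) {t : ℝ} (ht : 0 ≤ t) (hL : MeasurableSet L)
    (hKL : ∀ r q, (r, q) ∈ L ↔ ∃ s, |s| ≤ t ∧ (r - s, q) ∈ K) :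
    (volume.prod ν) L = (volume.prod ν) K + ENNReal.ofReal (2 * t) * ν (Prod.snd '' K) := by
  have hQ : MeasurableSet (Prod.snd '' K) := (hK.image continuous_snd).measurableSet
  have hfib : ∀ q, volume ((fun r => (r, q)) ⁻¹' L) = volume ((fun r => (r, q)) ⁻¹' K) +
      ENNReal.ofReal (2 * t) * (Prod.snd '' K).indicator 1 q := by
    intro q
    by_cases hq : q ∈ Prod.snd '' K
    · have hcK : IsCompact ((fun r : ℝ => (r, q)) ⁻¹' K) :=
        (Topology.IsClosedEmbedding.of_continuous_injective_isClosedMap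
          (f := fun r : ℝ => (r, q)) (by fun_prop) (fun a b h => (Prod.ext_iff.1 h).1)
          (fun s hs => by
            have : (fun r : ℝ => (r, q)) '' s = s ×ˢ {q} := by
              ext ⟨a, b⟩; simp [eq_comm, and_comm]
            rw [this]; exact hs.prod isClosed_singleton)).isCompact_preimage hK
      have hcv : Convex ℝ ((fun r : ℝ => (r, q)) ⁻¹' K) := by
        intro a ha b hb x y hx hy hxy
        have := hKc ha hb hx hy hxy
        simp only [mem_preimage]
        convert this using 1
        ext1
        · simp
        · simp [← add_smul, hxy]
      have hne : ((fun r : ℝ => (r, q)) ⁻¹' K).Nonempty := by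
        obtain ⟨⟨r, q'⟩, h, rfl⟩ := hq
        exact ⟨r, h⟩
      have hI := eq_Icc_of_connected_compact ⟨hne, hcv.isPreconnected⟩ hcK
      set a := sInf ((fun r : ℝ => (r, q)) ⁻¹' K)
      set b := sSup ((fun r : ℝ => (r, q)) ⁻¹' K)
      have hab : a ≤ b := by
        rw [hI] at hne; exact nonempty_Icc.1 hne
      have hI' : ∀ r, (r, q) ∈ K ↔ r ∈ Icc a b := fun r => by rw [← hI]; rfl
      -- The fibre interval grows by t at each end; conversely the shift s is r minus its nearest
      -- point in [a, b].
      have hL' : (fun r : ℝ => (r, q)) ⁻¹' L = Icc (a - t) (b + t) := by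
        ext r
        simp only [mem_preimage, hKL, hI', mem_Icc, abs_le]
        constructor
        · rintro ⟨s, ⟨_, _⟩, _, _⟩
          constructor <;> linarith
        · rintro ⟨h1, h2⟩
          rcases le_total r a with h | h
          · exact ⟨r - a, ⟨by linarith, by linarith⟩, by linarith, by linarith⟩
          rcases le_total r b with h' | h'
          · exact ⟨0, ⟨by linarith, by linarith⟩, by linarith, by linarith⟩
          · exact ⟨r - b, ⟨by linarith, by linarith⟩, by linarith, by linarith⟩
      rw [hL', hI, Real.volume_Icc, Real.volume_Icc, indicator_of_mem hq, Pi.one_apply, mul_one,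
        ← ENNReal.ofReal_add (by linarith) (by linarith)]
      congr 1
      ring
    · have h1 : (fun r : ℝ => (r, q)) ⁻¹' K = ∅ := by
        ext r; simp only [mem_preimage, mem_empty_iff_false, iff_false]
        exact fun h => hq ⟨_, h, rfl⟩
      have h2 : (fun r : ℝ => (r, q)) ⁻¹' L = ∅ := by
        ext r; simp only [mem_preimage, mem_empty_iff_false, iff_false, hKL]
        rintro ⟨s, -, h⟩
        exact hq ⟨_, h, rfl⟩
      simp [h1, h2, hq]
  rw [Measure.prod_apply_symm hL, Measure.prod_apply_symm hK.measurableSet]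
  simp_rw [hfib]
  rw [lintegral_add_left (measurable_measure_prodMk_right hK.measurableSet),
    lintegral_const_mul _ (measurable_one.indicator hQ), lintegral_indicator_one hQ]

end Cylinder

/-! ### Oblique coordinates, projections and widths -/

section Coordinates

variable {E : Type*} [NormedAddCommGroup E] [InnerProductSpace ℝ E]

/-- The coordinates `(r, q) ↦ r u + q`, with `q` in the hyperplane `v^⊥`. -/
noncomputable def hyperplaneCoords (u v : E) (huv : inner ℝ u v ≠ 0) :
    (ℝ × (ℝ ∙ v)ᗮ) ≃ₗ[ℝ] E where
  toFun z := z.1 • u + z.2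
  map_add' x y := by simp only [Prod.fst_add, Prod.snd_add, Submodule.coe_add]; module
  map_smul' c x := by simp only [Prod.smul_fst, Prod.smul_snd, Submodule.coe_smul, smul_eq_mul,
    RingHom.id_apply]; module
  invFun P := (inner ℝ P v / inner ℝ u v, ⟨P - (inner ℝ P v / inner ℝ u v) • u, by
    rw [Submodule.mem_orthogonal_singleton_iff_inner_left, inner_sub_left, inner_smul_left]
    simp [huv]⟩)
  left_inv z := by
    have h : inner ℝ (z.2 : E) v = 0 :=
      Submodule.mem_orthogonal_singleton_iff_inner_left.1 z.2.2
    have h1 : inner ℝ (z.1 • u + (z.2 : E)) v / inner ℝ u v = z.1 := by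
      rw [inner_add_left, inner_smul_left, h]
      simp [huv]
    simp only [h1]
    ext <;> simp
  right_inv P := by simp

theorem image_inner_eq_Icc {K : Set E} (hK : IsCompact K) (hc : Convex ℝ K) (hne : K.Nonempty)
    (v : E) : (fun k => inner ℝ k v) '' K = Icc (-supportFn K (-v)) (supportFn K v) := by
  obtain ⟨p, hp, hp'⟩ := exists_inner_eq_supportFn hK hne v
  obtain ⟨q, hq, hq'⟩ := exists_inner_eq_supportFn hK hne (-v)
  rw [inner_neg_right] at hq'
  refine Subset.antisymm ?_ ?_
  · rintro _ ⟨k, hk, rfl⟩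
    have h1 := inner_le_supportFn hK hk v
    have h2 := inner_le_supportFn hK hk (-v)
    rw [inner_neg_right] at h2
    exact ⟨by simp only; linarith, h1⟩
  · have := hc.isPreconnected.image (fun k => inner ℝ k v) (by fun_prop)
    refine this.Icc_subset ⟨q, hq, ?_⟩ ⟨p, hp, hp'⟩
    simp only
    linarith

theorem width_nonneg {K : Set E} (hK : IsCompact K) (hne : K.Nonempty) (v : E) :
    0 ≤ supportFn K v + supportFn K (-v) := by
  obtain ⟨k, hk⟩ := hne
  have h1 := inner_le_supportFn hK hk v
  have h2 := inner_le_supportFn hK hk (-v)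
  rw [inner_neg_right] at h2
  linarith

variable [FiniteDimensional ℝ E] [MeasurableSpace E] [BorelSpace E]
  (μ : Measure E) [μ.IsAddHaarMeasure]

/-- With `b` the (suitably normalized) area of the projection of `K` in direction `u`, adding
a segment in direction `u` adds `2 t b` to the volume, and `b` times the width of `K` is
the weighted volume of the set of points for which the line in direction `u` and the hyperplane
orthogonal to `v` both meet `K`. -/
theorem exists_projection_content {K : Set E} (hK : IsCompact K) (hc : Convex ℝ K)
    (hne : K.Nonempty) {u v : E} (huv : inner ℝ u v ≠ 0) : ∃ b : ℝ, 0 ≤ b ∧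
      (∀ t : ℝ, 0 ≤ t → μ.real (K + symmSegment (t • u)) = μ.real K + 2 * t * b) ∧
      ENNReal.ofReal |inner ℝ u v| *
        μ {P | (∃ t : ℝ, P + t • u ∈ K) ∧ ∃ k ∈ K, inner ℝ (k - P) v = 0} =
        ENNReal.ofReal ((supportFn K v + supportFn K (-v)) * b) := by
  set T := (hyperplaneCoords u v huv).toContinuousLinearEquiv with hT
  have hTa : ∀ r q, T (r, q) = r • u + q := fun r q => rfl
  set ν : Measure (ℝ × (ℝ ∙ v)ᗮ) := volume.prod volume with hν
  -- The Jacobian c need not be known: it enters both claims only through the product b = c · |Q|.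
  obtain ⟨c, hctop, hμ⟩ : ∃ c : ENNReal, c ≠ ⊤ ∧ μ = c • ν.map T :=
    ⟨_, ENNReal.coe_ne_top, Measure.isAddLeftInvariant_eq_smul μ (ν.map T)⟩
  have hμ' : ∀ S : Set E, μ S = c * ν (T ⁻¹' S) := fun S => by
    rw [hμ, Measure.smul_apply, smul_eq_mul]
    congr 1
    exact T.toHomeomorph.toMeasurableEquiv.map_apply S
  set K' := T ⁻¹' K with hK'
  have hK'c : IsCompact K' := T.toHomeomorph.isCompact_preimage.2 hK
  have hK'v : Convex ℝ K' := hc.linear_preimage T.toLinearEquiv.toLinearMap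
  set Q := Prod.snd '' K' with hQ
  have hQc : IsCompact Q := hK'c.image continuous_snd
  have hQtop : c * volume Q ≠ ⊤ := ENNReal.mul_ne_top hctop hQc.measure_lt_top.ne
  refine ⟨(c * volume Q).toReal, ENNReal.toReal_nonneg, fun t ht => ?_, ?_⟩
  · have hL : IsCompact (K + symmSegment (t • u)) := hK.add (isCompact_symmSegment _)
    have h1 := prod_measure_add_segment (volume : Measure (ℝ ∙ v)ᗮ) hK'c hK'v ht
      (L := T ⁻¹' (K + symmSegment (t • u)))
      (T.continuous.measurable hL.measurableSet) (fun r q => by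
        simp only [mem_preimage, hK', hTa, Set.mem_add, mem_symmSegment]
        constructor
        · rintro ⟨k, hk, _, ⟨s, hs, rfl⟩, h⟩
          refine ⟨s * t, ?_, ?_⟩
          · rw [abs_mul, abs_of_nonneg ht]
            exact mul_le_of_le_one_left ht hs
          · convert hk using 1
            rw [← sub_eq_iff_eq_add.2 h.symm]
            module
        · rintro ⟨s, hs, h⟩
          refine ⟨_, h, s • u, ?_, by module⟩
          rcases ht.eq_or_lt with rfl | ht'
          · have : s = 0 := by simpa using hs
            exact ⟨0, by simp, by simp [this]⟩
          · refine ⟨s / t, ?_, ?_⟩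
            · rw [abs_div, abs_of_pos ht']
              exact div_le_one_of_le₀ hs ht
            · rw [smul_smul, div_mul_cancel₀ _ ht'.ne'])
    rw [Measure.real, Measure.real, hμ', h1, ← hν, mul_add, ENNReal.toReal_add, ← hμ',
      mul_left_comm, ENNReal.toReal_mul, ENNReal.toReal_ofReal (by positivity)]
    · rw [← hμ']; exact hK.measure_lt_top.ne
    · rw [mul_left_comm]
      exact ENNReal.mul_ne_top ENNReal.ofReal_ne_top hQtop
  -- As q ⊥ v, the plane condition constrains r alone and the line condition q alone, so the set is
  -- a product.
  · have hset : T ⁻¹' {P | (∃ t : ℝ, P + t • u ∈ K) ∧ ∃ k ∈ K, inner ℝ (k - P) v = 0} =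
        ((fun r => r * inner ℝ u v) ⁻¹' Icc (-supportFn K (-v)) (supportFn K v)) ×ˢ Q := by
      ext ⟨r, q⟩
      have hq : inner ℝ (q : E) v = 0 :=
        Submodule.mem_orthogonal_singleton_iff_inner_left.1 q.2
      simp only [mem_preimage, mem_ofPred_eq, hTa, mem_prod, ← image_inner_eq_Icc hK hc hne, hQ,
        mem_image, Prod.exists, exists_eq_right, hK']
      rw [and_comm]
      refine and_congr ?_ ?_
      · refine exists_congr fun k => and_congr_right fun _ => ?_
        rw [inner_sub_left, inner_add_left, hq, inner_smul_left, sub_eq_zero]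
        simp
      · constructor
        · rintro ⟨t, h⟩
          exact ⟨r + t, by convert h using 1; module⟩
        · rintro ⟨s, h⟩
          exact ⟨s - r, by convert h using 1; module⟩
    have hw := width_nonneg hK hne v
    rw [hμ', hset, hν, Measure.prod_prod, Real.volume_preimage_mul_right huv, Real.volume_Icc,
      sub_neg_eq_add, abs_inv, ENNReal.ofReal_mul hw, ENNReal.ofReal_toReal hQtop]
    rw [show ∀ a b d e f : ENNReal, a * (e * (b * d * f)) = (a * b) * (d * (e * f)) by
      intros; ring, ← ENNReal.ofReal_mul (abs_nonneg _), mul_inv_cancel₀ (abs_ne_zero.2 huv)]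
    simp

end Coordinates

/-! ### Polynomial volume growth under sums of segments -/

section Zonotope

variable {E : Type*} [NormedAddCommGroup E] [InnerProductSpace ℝ E]

theorem symmSegment_zero : symmSegment (0 : E) = {0} := by
  simp [symmSegment]

theorem isCompact_sum_symmSegment {ι : Type*} (s : Finset ι) (x : ι → E) :
    IsCompact (∑ i ∈ s, symmSegment (x i)) := by
  classical
  induction s using Finset.induction_on with
  | empty => simp
  | insert i s hi ih =>
    rw [Finset.sum_insert hi]
    exact (isCompact_symmSegment _).add ih

theorem convex_sum_symmSegment {ι : Type*} (s : Finset ι) (x : ι → E) :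
    Convex ℝ (∑ i ∈ s, symmSegment (x i)) := by
  classical
  induction s using Finset.induction_on with
  | empty => exact convex_singleton (𝕜 := ℝ) (0 : E)
  | insert i s hi ih =>
    rw [Finset.sum_insert hi]
    exact (convex_symmSegment _).add ih

theorem nonempty_sum_symmSegment {ι : Type*} (s : Finset ι) (x : ι → E) :
    (∑ i ∈ s, symmSegment (x i)).Nonempty := by
  classical
  induction s using Finset.induction_on with
  | empty => simp
  | insert i s hi ih =>
    rw [Finset.sum_insert hi]
    exact (nonempty_symmSegment _).add ih

theorem supportFn_sum_symmSegment {ι : Type*} (s : Finset ι) (x : ι → E) (y : E) :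
    supportFn (∑ i ∈ s, symmSegment (x i)) y = ∑ i ∈ s, |inner ℝ (x i) y| := by
  classical
  induction s using Finset.induction_on with
  | empty => simp [supportFn]
  | insert i s hi ih =>
    rw [Finset.sum_insert hi, supportFn_add (isCompact_symmSegment _)
      (isCompact_sum_symmSegment s x) (nonempty_symmSegment _) (nonempty_sum_symmSegment s x),
      ih, Finset.sum_insert hi, supportFn_symmSegment]

/-- Test the support function at p itself. -/
theorem norm_le_of_mem_sum_symmSegment {ι : Type*} (s : Finset ι) (x : ι → E) {p : E}
    (hp : p ∈ ∑ i ∈ s, symmSegment (x i)) : ‖p‖ ≤ ∑ i ∈ s, ‖x i‖ := by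
  have h := inner_le_supportFn (isCompact_sum_symmSegment s x) hp p
  rw [supportFn_sum_symmSegment, real_inner_self_eq_norm_sq] at h
  have h2 : ∑ i ∈ s, |inner ℝ (x i) p| ≤ (∑ i ∈ s, ‖x i‖) * ‖p‖ := by
    rw [Finset.sum_mul]
    exact Finset.sum_le_sum fun i _ => abs_real_inner_le_norm _ _
  by_contra! hlt
  have : 0 ≤ ∑ i ∈ s, ‖x i‖ := Finset.sum_nonneg fun i _ => norm_nonneg _
  nlinarith

variable [MeasurableSpace E] (μ : Measure E)

/-- The volume gained by adding to `K` the segment from `-x` to `x`; for a unit vector `x` it is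
twice the area of the projection of `K` in direction `x`. -/
noncomputable def segmentGain (K : Set E) (x : E) : ℝ := μ.real (K + symmSegment x) - μ.real K

variable [FiniteDimensional ℝ E] [BorelSpace E] [μ.IsAddHaarMeasure]

theorem measureReal_add_symmSegment_smul {K : Set E} (hK : IsCompact K) (hc : Convex ℝ K)
    (hne : K.Nonempty) (x : E) {t : ℝ} (ht : 0 ≤ t) :
    μ.real (K + symmSegment (t • x)) = μ.real K + t * segmentGain μ K x := by
  rcases eq_or_ne x 0 with rfl | hx
  · simp [segmentGain, symmSegment_zero]
  -- Only the direction x matters here, so v = x serves as a transversal normal.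
  · obtain ⟨b, -, hb, -⟩ := exists_projection_content μ hK hc hne (inner_self_ne_zero.2 hx)
    have h1 := hb 1 zero_le_one
    rw [one_smul] at h1
    rw [hb t ht, segmentGain, h1]
    ring

theorem segmentGain_nonneg {K : Set E} (hK : IsCompact K) (hc : Convex ℝ K)
    (hne : K.Nonempty) (x : E) : 0 ≤ segmentGain μ K x := by
  rcases eq_or_ne x 0 with rfl | hx
  · simp [segmentGain, symmSegment_zero]
  · obtain ⟨b, hb0, hb, -⟩ := exists_projection_content μ hK hc hne (inner_self_ne_zero.2 hx)
    have h1 := hb 1 zero_le_one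
    rw [one_smul] at h1
    rw [segmentGain, h1]
    linarith

-- Induction on the segments, for all K at once. Adding the segment of ρ x_i to K + ρZ costs ρ times
-- the difference of the volumes of (K + segment of x_i) + ρZ and K + ρZ; both are polynomials q and
-- p by induction, whence p + X(q − p). The degree is so far bounded only by the number of segments.
open Polynomial in
theorem exists_polynomial_measureReal_add_zonotope {ι : Type*} (s : Finset ι) (x : ι → E)
    {K : Set E} (hK : IsCompact K) (hc : Convex ℝ K) (hne : K.Nonempty) :
    ∃ p : ℝ[X], p.coeff 0 = μ.real K ∧ p.coeff 1 = ∑ i ∈ s, segmentGain μ K (x i) ∧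
      ∀ ρ : ℝ, 0 ≤ ρ → μ.real (K + ∑ i ∈ s, symmSegment (ρ • x i)) = p.eval ρ := by
  classical
  induction s using Finset.induction_on generalizing K with
  | empty => exact ⟨C (μ.real K), by simp, by simp, by simp⟩
  | insert i s hi ih =>
    obtain ⟨p, hp0, hp1, hp⟩ := ih hK hc hne
    obtain ⟨q, hq0, hq1, hq⟩ := ih (hK.add (isCompact_symmSegment (x i)))
      (hc.add (convex_symmSegment (x i))) (hne.add (nonempty_symmSegment (x i)))
    refine ⟨p + X * (q - p), ?_, ?_, fun ρ hρ => ?_⟩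
    · simp [hp0]
    · rw [coeff_add, coeff_X_mul, coeff_sub, hp0, hp1, hq0, Finset.sum_insert hi, segmentGain]
      ring
    · have h1 := measureReal_add_symmSegment_smul μ
        (hK.add (isCompact_sum_symmSegment s fun i => ρ • x i))
        (hc.add (convex_sum_symmSegment s fun i => ρ • x i))
        (hne.add (nonempty_sum_symmSegment s fun i => ρ • x i)) (x i) hρ
      have h2 : K + ∑ i ∈ s, symmSegment (ρ • x i) + symmSegment (x i) =
          K + symmSegment (x i) + ∑ i ∈ s, symmSegment (ρ • x i) := by abel
      rw [Finset.sum_insert hi, add_comm (symmSegment _), ← add_assoc, h1, segmentGain, h2, hq ρ hρ,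
        hp ρ hρ]
      simp

-- A polynomial of larger degree would have an unbounded quotient by q.
open Polynomial in
theorem natDegree_le_of_eval_le {p q : ℝ[X]} (hq : q ≠ 0)
    (h : ∀ᶠ ρ : ℝ in atTop, |p.eval ρ| ≤ q.eval ρ) : p.natDegree ≤ q.natDegree := by
  by_contra! hlt
  have ht := abs_div_tendsto_atTop_atTop_of_degree_gt p q (degree_lt_degree hlt) hq
  obtain ⟨ρ, h1, h3⟩ := ((ht.eventually_gt_atTop 1).and h).exists
  rw [abs_div] at h1
  have h4 : |p.eval ρ| ≤ |q.eval ρ| := h3.trans (le_abs_self _)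
  exact absurd (div_le_one_of_le₀ h4 (abs_nonneg _)) (not_le.2 h1)

open Polynomial in
/-- Steiner's formula for zonotopes: the volume of `K + ρ Z` is a polynomial in `ρ`. -/
theorem exists_polynomial_measureReal_add_zonotope_natDegree_le {ι : Type*} (s : Finset ι)
    (x : ι → E) {K : Set E} (hK : IsCompact K) (hc : Convex ℝ K) (hne : K.Nonempty) :
    ∃ p : ℝ[X], p.natDegree ≤ Module.finrank ℝ E ∧
      p.coeff 1 = ∑ i ∈ s, segmentGain μ K (x i) ∧
      ∀ ρ : ℝ, 0 ≤ ρ → μ.real (K + ∑ i ∈ s, symmSegment (ρ • x i)) = p.eval ρ := by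
  obtain ⟨p, -, hp1, hp⟩ := exists_polynomial_measureReal_add_zonotope μ s x hK hc hne
  refine ⟨p, ?_, hp1, hp⟩
  obtain ⟨R, hR, hKR⟩ := hK.isBounded.exists_pos_norm_le
  set S := ∑ i ∈ s, ‖x i‖ with hS
  have hS0 : 0 ≤ S := Finset.sum_nonneg fun i _ => norm_nonneg _
  set m := μ.real (ball (0 : E) 1) with hm
  have hm0 : 0 < m := ENNReal.toReal_pos (measure_ball_pos μ 0 one_pos).ne' measure_ball_lt_top.ne
  -- Volume of the ball of radius Sρ + R, which contains K + ρZ.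
  set q : ℝ[X] := (C S * X + C R) ^ Module.finrank ℝ E * C m with hq
  have hqev : ∀ ρ, q.eval ρ = (S * ρ + R) ^ Module.finrank ℝ E * m := fun ρ => by simp [hq]
  have hq0 : q ≠ 0 := by
    intro h0
    have := hqev 0
    rw [h0] at this
    simp at this
    rcases this with h | h
    · exact hR.ne' h.1
    · exact hm0.ne' h
  refine (natDegree_le_of_eval_le hq0 ?_).trans ?_
  · filter_upwards [eventually_ge_atTop 0] with ρ hρ
    rw [← hp ρ hρ, abs_of_nonneg measureReal_nonneg, hqev]
    have hpos : 0 ≤ S * ρ + R := by positivity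
    have hsub : K + ∑ i ∈ s, symmSegment (ρ • x i) ⊆ closedBall 0 (S * ρ + R) := by
      rintro _ ⟨k, hk, z, hz, rfl⟩
      have h1 := norm_le_of_mem_sum_symmSegment s _ hz
      simp_rw [norm_smul, ← Finset.mul_sum, Real.norm_of_nonneg hρ, ← hS] at h1
      simp only [mem_closedBall_zero_iff]
      linarith [norm_add_le k z, hKR k hk]
    calc μ.real (K + ∑ i ∈ s, symmSegment (ρ • x i)) ≤ μ.real (closedBall 0 (S * ρ + R)) :=
          measureReal_mono hsub measure_closedBall_lt_top.ne
      _ = _ := by rw [μ.addHaar_real_closedBall _ hpos]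
  · refine natDegree_mul_C_le _ _ |>.trans (natDegree_pow_le.trans ?_)
    exact (Nat.mul_le_mul_left _ natDegree_linear_le).trans_eq (mul_one _)

theorem continuous_segmentGain {K : Set E} (hK : IsCompact K) (hc : Convex ℝ K)
    (hne : K.Nonempty) : Continuous (segmentGain μ K) := by
  refine Continuous.sub (continuous_iff_continuousAt.2 fun x => ?_) continuous_const
  refine tendsto_measureReal_of_tendsto_supportFn μ (ε := fun z => ‖z - x‖)
    (fun z => hK.add (isCompact_symmSegment z)) (fun z => hc.add (convex_symmSegment z))
    (fun z => hne.add (nonempty_symmSegment z)) (hK.add (isCompact_symmSegment x))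
    (hc.add (convex_symmSegment x)) (hne.add (nonempty_symmSegment x)) ?_ fun z y => ?_
  · exact tendsto_iff_norm_sub_tendsto_zero.1 tendsto_id
  · rw [supportFn_add hK (isCompact_symmSegment _) hne (nonempty_symmSegment _),
      supportFn_add hK (isCompact_symmSegment _) hne (nonempty_symmSegment _),
      supportFn_symmSegment, supportFn_symmSegment, add_sub_add_left_eq_sub]
    refine (abs_abs_sub_abs_le_abs_sub _ _).trans ?_
    rw [← inner_sub_left]
    exact abs_real_inner_le_norm _ _

end Zonotope

/-! ### Polar coordinates and integrals over the sphere -/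

section Sphere

theorem measurePreserving_polar : MeasurePreserving (homeomorphUnitSphereProd E3)
    ((volume : Measure E3).comap (↑)) (sphereMeasure.prod (Measure.volumeIoiPow 2)) := by
  have h := (volume : Measure E3).measurePreserving_homeomorphUnitSphereProd
  rwa [finrank_euclideanSpace_fin] at h

/-- The volume of a set in polar coordinates. -/
theorem volume_eq_lintegral_polar {S : Set E3} (hS : MeasurableSet S) :
    (volume : Measure E3) S =
      ∫⁻ u, Measure.volumeIoiPow 2 {r : Ioi (0 : ℝ) | (r : ℝ) • (u : E3) ∈ S} ∂sphereMeasure := by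
  set T := (homeomorphUnitSphereProd E3).symm ⁻¹' ((↑) ⁻¹' S) with hT
  have hTm : MeasurableSet T :=
    (homeomorphUnitSphereProd E3).symm.continuous.measurable (measurable_subtype_coe hS)
  have h1 : (volume : Measure E3) S = (volume : Measure E3).comap (↑)
      ((↑) ⁻¹' S : Set ({0}ᶜ : Set E3)) := by
    rw [comap_subtype_coe_apply (measurableSet_singleton (0 : E3)).compl,
      Subtype.image_preimage_coe, inter_comm]
    exact (measure_sdiff_null (measure_singleton _)).symm
  have h2 : ((↑) ⁻¹' S : Set ({0}ᶜ : Set E3)) = homeomorphUnitSphereProd E3 ⁻¹' T := by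
    ext x; simp [hT]
  rw [h1, h2, measurePreserving_polar.measure_preimage hTm.nullMeasurableSet,
    Measure.prod_apply hTm]
  rfl

/-- Integration in polar coordinates of a product of a radial and an angular function. -/
theorem integral_polar_mul {f : E3 → ℝ} {g : S2 → ℝ} {h : ℝ → ℝ}
    (hf : ∀ (u : S2) (r : ℝ), 0 < r → f (r • (u : E3)) = g u * h r) :
    ∫ x, f x = (∫ u, g u ∂sphereMeasure) * ∫ r in Ioi (0 : ℝ), r ^ 2 * h r := by
  calc ∫ x, f x = ∫ x : ({0}ᶜ : Set E3), f x ∂((volume : Measure E3).comap (↑)) := by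
        rw [integral_subtype_comap (measurableSet_singleton _).compl, restrict_compl_singleton]
    _ = ∫ x, g x.1 * h x.2 ∂(sphereMeasure.prod (Measure.volumeIoiPow 2)) := by
        rw [← measurePreserving_polar.integral_comp (Homeomorph.measurableEmbedding _)]
        refine integral_congr_ae (ae_of_all _ fun x => ?_)
        simp only
        rw [← hf _ _ (homeomorphUnitSphereProd E3 x).2.2, ← homeomorphUnitSphereProd_symm_apply_coe,
          Homeomorph.symm_apply_apply]
    _ = (∫ u, g u ∂sphereMeasure) * ∫ r : Ioi (0 : ℝ), h r ∂(Measure.volumeIoiPow 2) :=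
        integral_prod_mul g (fun r : Ioi (0 : ℝ) => h r)
    _ = _ := by
        congr 1
        simp only [Measure.volumeIoiPow, ENNReal.ofReal]
        rw [integral_withDensity_eq_integral_smul
          (measurable_subtype_coe.pow_const _).real_toNNReal,
          integral_subtype_comap measurableSet_Ioi fun a ↦ Real.toNNReal (a ^ 2) • h a]
        refine setIntegral_congr_fun measurableSet_Ioi fun x _ => ?_
        rw [NNReal.smul_def, Real.coe_toNNReal _ (sq_nonneg x), smul_eq_mul]

theorem sphereMeasure_real_univ : sphereMeasure.real univ = 4 * Real.pi := by
  rw [Measure.toSphere_real_apply_univ, finrank_euclideanSpace_fin, Measure.real,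
    EuclideanSpace.volume_ball_fin_three]
  rw [ENNReal.ofReal_one, one_pow, one_mul, ENNReal.toReal_ofReal (by positivity)]
  push_cast
  ring

theorem integral_Ioi_mul_exp_neg_sq : ∫ t in Ioi (0 : ℝ), t * Real.exp (-t ^ 2) = 1 / 2 := by
  have h := integral_rpow_mul_exp_neg_rpow (p := 2) (q := 1) (by norm_num) (by norm_num)
  norm_num at h
  rw [← h]

theorem integral_Ioi_pow_three_mul_exp_neg_sq :
    ∫ t in Ioi (0 : ℝ), t ^ 3 * Real.exp (-t ^ 2) = 1 / 2 := by
  have h := integral_rpow_mul_exp_neg_rpow (p := 2) (q := 3) (by norm_num) (by norm_num)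
  norm_num at h
  rw [← h]

/-- Rotating y to a coordinate axis splits the integral into 1 · √π · √π. -/
theorem integral_abs_inner_mul_gaussian {y : E3} (hy : ‖y‖ = 1) :
    ∫ z : E3, |inner ℝ z y| * Real.exp (-‖z‖ ^ 2) = Real.pi := by
  obtain ⟨b, hb⟩ := Orthonormal.exists_orthonormalBasis_extension_of_card_eq (𝕜 := ℝ) (E := E3)
    (ι := Fin 3) (by simp) (v := fun _ => y) (s := {0})
    (by
      constructor
      · simp [hy]
      · intro i j hij
        exact absurd (Subtype.ext (by rw [i.2, j.2])) hij)
  have hb0 : b 0 = y := hb 0 rfl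
  have h1 : ∫ z : E3, |inner ℝ z y| * Real.exp (-‖z‖ ^ 2) =
      ∫ w : E3, |w 0| * Real.exp (-‖w‖ ^ 2) := by
    rw [← b.measurePreserving_repr.integral_comp b.repr.toHomeomorph.measurableEmbedding
      (fun w : E3 => |w 0| * Real.exp (-‖w‖ ^ 2))]
    refine integral_congr_ae (ae_of_all _ fun z => ?_)
    simp only [LinearIsometryEquiv.norm_map]
    rw [b.repr_apply_apply, hb0, real_inner_comm]
  set f : Fin 3 → ℝ → ℝ := ![fun t => |t| * Real.exp (-t ^ 2), fun t => Real.exp (-t ^ 2),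
    fun t => Real.exp (-t ^ 2)] with hf
  have h2 : ∫ w : E3, |w 0| * Real.exp (-‖w‖ ^ 2) = ∫ w : Fin 3 → ℝ, ∏ i, f i (w i) := by
    rw [← (EuclideanSpace.volume_preserving_symm_measurableEquiv_toLp (Fin 3)).integral_comp
      (MeasurableEquiv.measurableEmbedding _)]
    refine integral_congr_ae (ae_of_all _ fun w => ?_)
    simp only [hf, Fin.prod_univ_three, EuclideanSpace.norm_sq_eq, Fin.sum_univ_three,
      Real.norm_eq_abs, sq_abs]
    simp only [Matrix.cons_val_zero, Matrix.cons_val_one, Matrix.cons_val]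
    rw [neg_add, neg_add, Real.exp_add, Real.exp_add]
    simp only [MeasurableEquiv.coe_toLp_symm]
    ring
  have h3 : ∫ t : ℝ, Real.exp (-t ^ 2) = √Real.pi := by
    have := integral_gaussian 1
    simpa using this
  have h4 : ∫ t : ℝ, |t| * Real.exp (-t ^ 2) = 1 := by
    have := integral_comp_abs (f := fun t => t * Real.exp (-t ^ 2))
    simp only [sq_abs] at this
    rw [this, integral_Ioi_mul_exp_neg_sq]
    norm_num
  rw [h1, h2, integral_fintype_prod_volume_eq_prod, Fin.prod_univ_three]
  simp only [hf, Matrix.cons_val_zero, Matrix.cons_val_one, Matrix.cons_val]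
  rw [h3, h4, one_mul, Real.mul_self_sqrt Real.pi_pos.le]

/-- The Gaussian integral π is, in polar coordinates, the spherical integral times ∫ r³ exp(−r²) dr
= 1/2. Thus the unit ball has the support function of an average of segments. -/
theorem integral_abs_inner_sphere (y : E3) :
    ∫ u : S2, |inner ℝ (u : E3) y| ∂sphereMeasure = 2 * Real.pi * ‖y‖ := by
  have unit : ∀ y : E3, ‖y‖ = 1 →
      ∫ u : S2, |inner ℝ (u : E3) y| ∂sphereMeasure = 2 * Real.pi := by
    intro y hy
    have h := integral_polar_mul (f := fun z => |inner ℝ z y| * Real.exp (-‖z‖ ^ 2))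
      (g := fun u => |inner ℝ (u : E3) y|) (h := fun r => r * Real.exp (-r ^ 2))
      (fun u r hr => by
        rw [inner_smul_left, norm_smul, norm_eq_of_mem_sphere, mul_one, Real.norm_of_nonneg hr.le]
        simp only [conj_trivial]
        rw [abs_mul, abs_of_pos hr]
        ring)
    rw [integral_abs_inner_mul_gaussian hy] at h
    have h2 : ∫ r in Ioi (0 : ℝ), r ^ 2 * (r * Real.exp (-r ^ 2)) = 1 / 2 := by
      rw [← integral_Ioi_pow_three_mul_exp_neg_sq]
      refine setIntegral_congr_fun measurableSet_Ioi fun x _ => ?_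
      ring
    rw [h2] at h
    linarith
  rcases eq_or_ne y 0 with rfl | hy
  · simp
  · have hy' : ‖y‖ ≠ 0 := norm_ne_zero_iff.2 hy
    have h := unit (‖y‖⁻¹ • y) (by rw [norm_smul, norm_inv, norm_norm, inv_mul_cancel₀ hy'])
    simp_rw [inner_smul_right, abs_mul, abs_inv, abs_norm] at h
    rw [integral_const_mul] at h
    rw [← h]
    field_simp

theorem measurePreserving_neg_sphere :
    MeasurePreserving (fun u : S2 => -u) sphereMeasure sphereMeasure := by
  have hm : Measurable (fun u : S2 => -u) := continuous_neg.measurable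
  refine ⟨hm, Measure.ext fun s hs => ?_⟩
  rw [Measure.map_apply hm hs, Measure.toSphere_apply' _ (hm hs), Measure.toSphere_apply' _ hs]
  congr 1
  have : Ioo (0 : ℝ) 1 • ((↑) '' ((fun u : S2 => -u) ⁻¹' s) : Set E3) =
      -(Ioo (0 : ℝ) 1 • ((↑) '' s : Set E3)) := by
    ext x
    simp only [Set.mem_neg, Set.mem_smul, mem_image, mem_preimage]
    constructor
    · rintro ⟨r, hr, _, ⟨u, hu, rfl⟩, rfl⟩
      exact ⟨r, hr, _, ⟨-u, hu, rfl⟩, by simp⟩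
    · rintro ⟨r, hr, _, ⟨u, hu, rfl⟩, h⟩
      exact ⟨r, hr, _, ⟨-u, by simpa using hu, rfl⟩, by simp [h]⟩
  rw [this, Measure.measure_neg]

/-- The cone over the exceptional directions lies in a proper subspace. -/
theorem ae_inner_ne_zero_sphere {v : E3} (hv : v ≠ 0) :
    ∀ᵐ u : S2 ∂sphereMeasure, inner ℝ (u : E3) v ≠ 0 := by
  have hm : MeasurableSet {u : S2 | inner ℝ (u : E3) v = 0} :=
    (isClosed_eq (by fun_prop) continuous_const).measurableSet
  rw [ae_iff]
  simp only [ne_eq, not_not]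
  rw [Measure.toSphere_apply' _ hm, mul_eq_zero]
  right
  refine measure_mono_null (t := ((ℝ ∙ v)ᗮ : Submodule ℝ E3)) ?_
    (Measure.addHaar_submodule _ _ fun h => hv ?_)
  · rintro _ ⟨r, -, _, ⟨u, hu, rfl⟩, rfl⟩
    simp only [SetLike.mem_coe]
    exact Submodule.smul_mem _ _ (Submodule.mem_orthogonal_singleton_iff_inner_left.2 hu)
  · have : v ∈ (ℝ ∙ v)ᗮ := h ▸ Submodule.mem_top
    exact inner_self_eq_zero.1 (Submodule.mem_orthogonal_singleton_iff_inner_left.1 this)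

end Sphere

/-! ### Steiner's formula and Cauchy's surface area formula -/

section Steiner

/-- Finitely many unit directions discretize the sphere, so that the ball becomes a limit of finite
sums of segments. -/
theorem exists_simpleFunc_approx_sphere : ∃ s : ℕ → SimpleFunc S2 E3,
    (∀ n u, ‖s n u‖ = 1) ∧ ∀ u : S2, Tendsto (fun n => s n u) atTop (𝓝 (u : E3)) := by
  have h0 : EuclideanSpace.single (0 : Fin 3) (1 : ℝ) ∈ sphere (0 : E3) 1 := by simp
  refine ⟨fun n => SimpleFunc.approxOn (Subtype.val : S2 → E3) measurable_subtype_coe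
    (sphere (0 : E3) 1) _ h0 n, fun n u => ?_, fun u => ?_⟩
  · simpa using SimpleFunc.approxOn_mem measurable_subtype_coe h0 n u
  · exact SimpleFunc.tendsto_approxOn measurable_subtype_coe h0 (subset_closure u.2)

open Polynomial in
/-- A pointwise limit of cubic polynomials is a cubic polynomial, and the linear coefficients
converge. -/
theorem exists_cubic_of_tendsto {p : ℕ → ℝ[X]} (hp : ∀ n, (p n).natDegree ≤ 3) {f : ℝ → ℝ}
    (hf : ∀ ρ, 0 ≤ ρ → Tendsto (fun n => (p n).eval ρ) atTop (𝓝 (f ρ))) {c : ℝ}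
    (hc : Tendsto (fun n => (p n).coeff 1) atTop (𝓝 c)) :
    ∃ a b : ℝ, ∀ ρ, 0 ≤ ρ → f ρ = f 0 + c * ρ + a * ρ ^ 2 + b * ρ ^ 3 := by
  have hev : ∀ n ρ, (p n).eval ρ = (p n).coeff 0 + (p n).coeff 1 * ρ + (p n).coeff 2 * ρ ^ 2 +
      (p n).coeff 3 * ρ ^ 3 := fun n ρ => by
    rw [eval_eq_sum_range' (Nat.lt_succ_of_le (hp n))]
    simp [Finset.sum_range_succ]
  have h0 := hf 0 le_rfl
  have h1 := hf 1 zero_le_one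
  have h2 := hf 2 zero_le_two
  have h3 := hf 3 zero_le_three
  have h0' : Tendsto (fun n => (p n).coeff 0) atTop (𝓝 (f 0)) := by
    refine h0.congr fun n => ?_
    rw [hev]; ring
  -- The quadratic and cubic coefficients, as finite differences of the values at 0, 1, 2, 3.
  have ha := ((h0.const_mul 2).sub (h1.const_mul 5)).add ((h2.const_mul 4).sub h3)
    |>.div_const 2
  have hb := ((h1.const_mul 3).sub h0).add (h3.sub (h2.const_mul 3)) |>.div_const 6
  refine ⟨_, _, fun ρ hρ => tendsto_nhds_unique (hf ρ hρ)
    (((h0'.add (hc.mul_const ρ)).add (ha.mul_const (ρ ^ 2))).add (hb.mul_const (ρ ^ 3))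
      |>.congr fun n => ?_)⟩
  simp only [hev]
  ring

theorem segmentGain_smul {K : Set E3} (hK : IsCompact K) (hc : Convex ℝ K)
    (hne : K.Nonempty) (x : E3) {t : ℝ} (ht : 0 ≤ t) :
    segmentGain volume K (t • x) = t * segmentGain volume K x := by
  rw [segmentGain, measureReal_add_symmSegment_smul volume hK hc hne x ht, add_sub_cancel_left]

theorem integrable_comp_sphere {g : E3 → ℝ} (hg : Continuous g) :
    Integrable (fun u : S2 => g u) sphereMeasure := by
  have hcont : Continuous fun u : S2 => g u := hg.comp continuous_subtype_val
  simpa using hcont.continuousOn.integrableOn_compact (μ := sphereMeasure) isCompact_univ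

theorem tendsto_integral_comp_simpleFunc {s : ℕ → SimpleFunc S2 E3} (hs : ∀ n u, ‖s n u‖ = 1)
    (hlim : ∀ u : S2, Tendsto (fun n => s n u) atTop (𝓝 (u : E3))) {g : S2 → E3 → ℝ}
    (hg : Continuous (Function.uncurry g)) :
    Tendsto (fun n => ∫ u, g u (s n u) ∂sphereMeasure) atTop
      (𝓝 (∫ u, g u u ∂sphereMeasure)) := by
  obtain ⟨B, hB⟩ := (isCompact_univ.prod (isCompact_sphere (0 : E3) 1)).exists_bound_of_continuousOn
    hg.continuousOn
  refine tendsto_integral_of_dominated_convergence (fun _ => B) (fun n => ?_)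
    (integrable_const B) (fun n => ae_of_all _ fun u => ?_) (ae_of_all _ fun u => ?_)
  · exact (hg.measurable.comp
      (measurable_id.prodMk (s n).measurable)).aestronglyMeasurable
  · exact hB (u, s n u) ⟨mem_univ _, by simpa using hs n u⟩
  · exact (hg.tendsto (u, (u : E3))).comp (tendsto_const_nhds.prodMk_nhds (hlim u))

theorem sum_range_simpleFunc (s : SimpleFunc S2 E3) {g : E3 → ℝ} (hg : g 0 = 0) :
    ∑ i ∈ s.range, sphereMeasure.real (s ⁻¹' {i}) * g i = ∫ u, g (s u) ∂sphereMeasure := by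
  have hint : Integrable s sphereMeasure := SimpleFunc.integrable_of_isFiniteMeasure s
  have h := SimpleFunc.map_integral s g hint hg
  rw [SimpleFunc.integral_eq_integral _ (SimpleFunc.integrable_of_isFiniteMeasure _)] at h
  simp only [smul_eq_mul] at h
  rw [← h]
  rfl

/-- Steiner's formula, with the linear coefficient given by Cauchy's surface area formula. -/
theorem exists_steiner_cubic {K : Set E3} (hK : IsCompact K) (hc : Convex ℝ K)
    (hne : K.Nonempty) : ∃ a b : ℝ, ∀ ρ, 0 ≤ ρ →
      volume.real (K + closedBall (0 : E3) ρ) = volume.real K +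
        ((2 * Real.pi)⁻¹ * ∫ u : S2, segmentGain volume K u ∂sphereMeasure) * ρ +
        a * ρ ^ 2 + b * ρ ^ 3 := by
  obtain ⟨s, hs, hlim⟩ := exists_simpleFunc_approx_sphere
  have hpi : 0 < 2 * Real.pi := by positivity
  -- With these weights the sum of segments has support function (2π)⁻¹ ∫ |⟨s n u, y⟩| du, close to
  -- ‖y‖.
  set w : ℕ → E3 → ℝ := fun n i => (2 * Real.pi)⁻¹ * sphereMeasure.real (s n ⁻¹' {i}) with hw
  have hw0 : ∀ n i, 0 ≤ w n i := fun n i => by positivity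
  have hsum : ∀ n (g : E3 → ℝ), g 0 = 0 → ∑ i ∈ (s n).range, w n i * g i =
      (2 * Real.pi)⁻¹ * ∫ u, g (s n u) ∂sphereMeasure := fun n g hg => by
    rw [← sum_range_simpleFunc _ hg, Finset.mul_sum]
    simp only [hw, mul_assoc]
  choose p hp3 hp1 hp using fun n => exists_polynomial_measureReal_add_zonotope_natDegree_le
    (volume : Measure E3) (s n).range (fun i => w n i • i) hK hc hne
  simp only [finrank_euclideanSpace_fin] at hp3
  have hgain : Tendsto (fun n => (p n).coeff 1) atTop
      (𝓝 ((2 * Real.pi)⁻¹ * ∫ u : S2, segmentGain volume K u ∂sphereMeasure)) := by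
    have h1 : ∀ n, (p n).coeff 1 =
        (2 * Real.pi)⁻¹ * ∫ u, segmentGain volume K (s n u) ∂sphereMeasure := fun n => by
      rw [hp1, ← hsum n _ (by simp [segmentGain, symmSegment_zero])]
      exact Finset.sum_congr rfl fun i _ => segmentGain_smul hK hc hne i (hw0 n i)
    simp_rw [h1]
    exact (tendsto_integral_comp_simpleFunc hs hlim (g := fun _ x => segmentGain volume K x)
      ((continuous_segmentGain volume hK hc hne).comp continuous_snd)).const_mul _
  -- The mean displacement of directions bounds the error of the support function relative to ‖y‖.
  set e : ℕ → ℝ := fun n => (2 * Real.pi)⁻¹ * ∫ u, ‖s n u - (u : E3)‖ ∂sphereMeasure with he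
  have helim : Tendsto e atTop (𝓝 0) := by
    have := (tendsto_integral_comp_simpleFunc hs hlim (g := fun u x => ‖x - (u : E3)‖)
      (by simp only [Function.uncurry_def]; fun_prop)).const_mul (2 * Real.pi)⁻¹
    simp only [sub_self, norm_zero, integral_zero, mul_zero] at this
    exact this
  have hinterr : ∀ n, Integrable (fun u : S2 => ‖s n u - (u : E3)‖) sphereMeasure := fun n =>
    ((SimpleFunc.integrable_of_isFiniteMeasure (s n)).sub
      (Integrable.of_bound (by fun_prop : Continuous fun u : S2 => (u : E3)).aestronglyMeasurable 1
        (ae_of_all _ fun u => by simp))).norm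
  have herr : ∀ n (y : E3), |∑ i ∈ (s n).range, w n i * |inner ℝ i y| - ‖y‖| ≤ e n * ‖y‖ := by
    intro n y
    have h1 : ‖y‖ = (2 * Real.pi)⁻¹ * ∫ u : S2, |inner ℝ (u : E3) y| ∂sphereMeasure := by
      rw [integral_abs_inner_sphere]
      field_simp
    have hi1 : Integrable (fun u => |inner ℝ (s n u) y|) sphereMeasure :=
      SimpleFunc.integrable_of_isFiniteMeasure ((s n).map fun x => |inner ℝ x y|)
    have hi2 : Integrable (fun u : S2 => |inner ℝ (u : E3) y|) sphereMeasure :=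
      integrable_comp_sphere (g := fun x => |inner ℝ x y|) (by fun_prop)
    rw [hsum n (fun i => |inner ℝ i y|) (by simp)]
    conv_lhs => rw [h1]
    rw [← mul_sub, ← integral_sub hi1 hi2, abs_mul, abs_of_pos (inv_pos.2 hpi), he, mul_assoc]
    refine mul_le_mul_of_nonneg_left ?_ (inv_pos.2 hpi).le
    rw [← integral_mul_const]
    refine abs_integral_le_integral_abs.trans (integral_mono (hi1.sub hi2).abs
      ((hinterr n).mul_const _) fun u => ?_)
    refine (abs_abs_sub_abs_le_abs_sub _ _).trans ?_
    rw [← inner_sub_left]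
    exact abs_real_inner_le_norm _ _
  have hconv : ∀ ρ, 0 ≤ ρ → Tendsto (fun n => (p n).eval ρ) atTop
      (𝓝 (volume.real (K + closedBall (0 : E3) ρ))) := by
    intro ρ hρ
    simp_rw [← hp _ ρ hρ]
    refine tendsto_measureReal_of_tendsto_supportFn volume (ε := fun n => ρ * e n)
      (fun n => hK.add (isCompact_sum_symmSegment _ _))
      (fun n => hc.add (convex_sum_symmSegment _ _))
      (fun n => hne.add (nonempty_sum_symmSegment _ _)) (hK.add (isCompact_closedBall _ _))
      (hc.add (convex_closedBall _ _)) (hne.add ⟨0, mem_closedBall_self hρ⟩)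
      (by simpa using helim.const_mul ρ) fun n y => ?_
    rw [supportFn_add hK (isCompact_sum_symmSegment _ _) hne (nonempty_sum_symmSegment _ _),
      supportFn_add hK (isCompact_closedBall _ _) hne ⟨0, mem_closedBall_self hρ⟩,
      supportFn_closedBall hρ, supportFn_sum_symmSegment, add_sub_add_left_eq_sub]
    have h1 : ∑ i ∈ (s n).range, |inner ℝ (ρ • w n i • i) y| =
        ρ * ∑ i ∈ (s n).range, w n i * |inner ℝ i y| := by
      rw [Finset.mul_sum]
      refine Finset.sum_congr rfl fun i _ => ?_
      rw [inner_smul_left, inner_smul_left, abs_mul, abs_mul]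
      simp only [conj_trivial]
      rw [abs_of_nonneg hρ, abs_of_nonneg (hw0 n i)]
    rw [h1, ← mul_sub, abs_mul, abs_of_nonneg hρ, mul_assoc]
    exact mul_le_mul_of_nonneg_left (herr n y) hρ
  obtain ⟨a, b, hab⟩ := exists_cubic_of_tendsto hp3 hconv hgain
  refine ⟨a, b, fun ρ hρ => ?_⟩
  rw [hab ρ hρ]
  simp

end Steiner

/-! ### Large parallel bodies and the mean width formula -/

section MeanWidth

theorem integral_polar_measureReal {S : Set E3} (hS : MeasurableSet S)
    (hfin : (volume : Measure E3) S ≠ ⊤) :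
    Integrable (fun u : S2 => (Measure.volumeIoiPow 2).real
      {r : Ioi (0 : ℝ) | (r : ℝ) • (u : E3) ∈ S}) sphereMeasure ∧
    (volume : Measure E3).real S = ∫ u : S2, (Measure.volumeIoiPow 2).real
      {r : Ioi (0 : ℝ) | (r : ℝ) • (u : E3) ∈ S} ∂sphereMeasure := by
  have hm : Measurable fun u : S2 => Measure.volumeIoiPow 2
      {r : Ioi (0 : ℝ) | (r : ℝ) • (u : E3) ∈ S} :=
    measurable_measure_prodMk_left (s := {z : S2 × Ioi (0 : ℝ) | (z.2 : ℝ) • (z.1 : E3) ∈ S})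
      ((by fun_prop : Continuous fun z : S2 × Ioi (0 : ℝ) => (z.2 : ℝ) • (z.1 : E3)).measurable hS)
  have h := volume_eq_lintegral_polar hS
  rw [h] at hfin
  refine ⟨integrable_toReal_of_lintegral_ne_top hm.aemeasurable hfin, ?_⟩
  simp only [Measure.real]
  rw [integral_toReal hm.aemeasurable (ae_lt_top hm hfin), h]

theorem volumeIoiPow_real_Iio {x : ℝ} (hx : 0 < x) :
    (Measure.volumeIoiPow 2).real (Iio ⟨x, hx⟩) = x ^ 3 / 3 := by
  rw [Measure.real, Measure.volumeIoiPow_apply_Iio, ENNReal.toReal_ofReal (by positivity)]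
  norm_num

/-- For a support point x in direction u, ‖ru − x‖² = (r − h)² + ‖x‖² − h² ≤ (r − h)² + R². The
margin R²/ρ absorbs the last term when r ≥ h; when r ≤ h, |r − h| ≤ R suffices. -/
theorem smul_mem_add_closedBall {K : Set E3} (hK : IsCompact K) (hne : K.Nonempty) {R : ℝ}
    (hR : 0 < R) (hKR : ∀ p ∈ K, ‖p‖ ≤ R) {ρ : ℝ} (hρ : 2 * R + 1 ≤ ρ) (u : S2) {r : ℝ}
    (hr : 0 < r) (h : r < ρ + supportFn K u - R ^ 2 / ρ) :
    r • (u : E3) ∈ K + closedBall (0 : E3) ρ := by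
  obtain ⟨x, hx, hxu⟩ := exists_inner_eq_supportFn hK hne (u : E3)
  refine ⟨x, hx, r • (u : E3) - x, ?_, by simp⟩
  have hρ0 : 0 < ρ := by linarith
  have hu : ‖(u : E3)‖ = 1 := norm_eq_of_mem_sphere u
  have hh := abs_le.1 (abs_supportFn_le hK hne hKR (u : E3))
  rw [hu, mul_one] at hh
  rw [mem_closedBall_zero_iff]
  refine abs_le_of_sq_le_sq' ?_ hρ0.le |>.2
  rw [norm_sub_sq_real, norm_smul, hu, inner_smul_left, real_inner_comm, hxu]
  simp only [conj_trivial, mul_one, Real.norm_eq_abs, sq_abs]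
  set s := supportFn K (u : E3) with hs
  have hx2 : ‖x‖ ^ 2 ≤ R ^ 2 := pow_le_pow_left₀ (norm_nonneg x) (hKR x hx) 2
  have hd : R ^ 2 / ρ * ρ = R ^ 2 := div_mul_cancel₀ _ hρ0.ne'
  have hd0 : 0 ≤ R ^ 2 / ρ := by positivity
  have hd1 : R ^ 2 / ρ ≤ R := by
    rw [div_le_iff₀ hρ0]; nlinarith
  have key : (r - s) ^ 2 + R ^ 2 ≤ ρ ^ 2 := by
    rcases le_total r s with h1 | h1
    · have : (r - s) ^ 2 ≤ R ^ 2 := by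
        apply sq_le_sq'
        · linarith
        · linarith
      nlinarith
    · have h2 : (r - s) ^ 2 ≤ (ρ - R ^ 2 / ρ) ^ 2 := by
        apply sq_le_sq'
        · linarith
        · linarith
      nlinarith
  nlinarith [sq_nonneg s]

/-- Pairing with u gives r ≤ ρ + h; the term 1/ρ only makes this strict, to fit an open interval
`Iio`. -/
theorem lt_of_smul_mem_add_closedBall {K : Set E3} (hK : IsCompact K) {ρ : ℝ} (hρ : 0 < ρ)
    (u : S2) {r : ℝ} (h : r • (u : E3) ∈ K + closedBall (0 : E3) ρ) :
    r < ρ + supportFn K u + 1 / ρ := by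
  obtain ⟨x, hx, z, hz, hxz⟩ := h
  have hu : ‖(u : E3)‖ = 1 := norm_eq_of_mem_sphere u
  have h1 := inner_le_supportFn hK hx (u : E3)
  have h2 := real_inner_le_norm z (u : E3)
  rw [hu, mul_one] at h2
  rw [mem_closedBall_zero_iff] at hz
  have h3 : inner ℝ (x + z) (u : E3) = r := by
    simp only at hxz
    rw [hxz, inner_smul_left, real_inner_self_eq_norm_sq, hu]
    simp
  rw [inner_add_left] at h3
  have : 0 < 1 / ρ := by positivity
  linarith

/-- An O(1/ρ) error in the radius changes the cube by O(ρ) only, below the ρ² term that is sought.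
-/
theorem abs_cube_sub_le {R D ρ h d : ℝ} (hR : 0 ≤ R) (hD : 0 ≤ D) (hρ : 1 ≤ ρ) (hh : |h| ≤ R)
    (hd : |d| * ρ ≤ D) :
    |(ρ + h + d) ^ 3 - (ρ ^ 3 + 3 * ρ ^ 2 * h)| ≤ (3 * D + 3 * (R + D) ^ 2 + (R + D) ^ 3) * ρ := by
  have hd' : |d| ≤ D := le_trans (le_mul_of_one_le_right (abs_nonneg d) hρ) hd
  have hx : |h + d| ≤ R + D := (abs_add_le h d).trans (add_le_add hh hd')
  have e : (ρ + h + d) ^ 3 - (ρ ^ 3 + 3 * ρ ^ 2 * h) =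
    3 * ρ ^ 2 * d + 3 * ρ * (h + d) ^ 2 + (h + d) ^ 3 := by ring
  have h1 : |3 * ρ ^ 2 * d| ≤ 3 * D * ρ := by
    rw [abs_mul, abs_of_nonneg (by positivity)]
    nlinarith
  have h2 : |3 * ρ * (h + d) ^ 2| ≤ 3 * (R + D) ^ 2 * ρ := by
    rw [abs_mul, abs_pow, abs_of_nonneg (by positivity)]
    have := pow_le_pow_left₀ (abs_nonneg _) hx 2
    nlinarith
  have h3 : |(h + d) ^ 3| ≤ (R + D) ^ 3 * ρ := by
    rw [abs_pow]
    exact (pow_le_pow_left₀ (abs_nonneg _) hx 3).trans (le_mul_of_one_le_right (by positivity) hρ)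
  rw [e]
  refine (abs_add_le _ _).trans ((add_le_add (abs_add_le _ _) le_rfl).trans ?_)
  linarith

/-- For large `ρ`, the volume of the outer parallel body is, up to `O(ρ)`, the sum of that of the
ball of radius `ρ` and `ρ ^ 2` times the integral of the support function. -/
theorem exists_abs_volume_add_closedBall_sub_le {K : Set E3} (hK : IsCompact K)
    (hne : K.Nonempty) : ∃ C : ℝ, ∀ᶠ ρ : ℝ in atTop,
      |volume.real (K + closedBall (0 : E3) ρ) - (4 * Real.pi / 3 * ρ ^ 3 +
        (∫ u : S2, supportFn K u ∂sphereMeasure) * ρ ^ 2)| ≤ C * ρ := by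
  obtain ⟨R, hR, hKR⟩ := hK.isBounded.exists_pos_norm_le
  -- Bounds |d| ρ for both corrections d = 1/ρ and d = −R²/ρ.
  set D := R ^ 2 + 1 with hD
  set C := 3 * D + 3 * (R + D) ^ 2 + (R + D) ^ 3 with hC
  refine ⟨4 * Real.pi * C / 3, ?_⟩
  filter_upwards [eventually_ge_atTop (2 * R + 1)] with ρ hρ
  have hρ1 : 1 ≤ ρ := by linarith
  have hρ0 : 0 < ρ := by linarith
  have hS : IsCompact (K + closedBall (0 : E3) ρ) := hK.add (isCompact_closedBall _ _)
  obtain ⟨hint, hvol⟩ := integral_polar_measureReal hS.measurableSet hS.measure_lt_top.ne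
  set m : S2 → ℝ := fun u => (Measure.volumeIoiPow 2).real
      {r : Ioi (0 : ℝ) | (r : ℝ) • (u : E3) ∈ K + closedBall (0 : E3) ρ} with hm
  have hh : ∀ u : S2, |supportFn K (u : E3)| ≤ R := fun u => by
    simpa using abs_supportFn_le hK hne hKR (u : E3)
  have hhint : Integrable (fun u : S2 => supportFn K (u : E3)) sphereMeasure :=
    integrable_comp_sphere (continuous_supportFn hK hne)
  have hd1 : R ^ 2 / ρ * ρ = R ^ 2 := div_mul_cancel₀ _ hρ0.ne'
  have hd2 : R ^ 2 / ρ ≤ R := by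
    rw [div_le_iff₀ hρ0]; nlinarith
  have hbound : ∀ u : S2, |m u - (ρ ^ 3 + 3 * ρ ^ 2 * supportFn K u) / 3| ≤ C * ρ / 3 := by
    intro u
    have hlo : 0 < ρ + supportFn K u - R ^ 2 / ρ := by
      have := (abs_le.1 (hh u)).1
      linarith
    have hup : 0 < ρ + supportFn K u + 1 / ρ := by
      have := (abs_le.1 (hh u)).1
      have : 0 < 1 / ρ := by positivity
      linarith
    have hsub1 : {r : Ioi (0 : ℝ) | (r : ℝ) • (u : E3) ∈ K + closedBall (0 : E3) ρ} ⊆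
        Iio ⟨_, hup⟩ := fun r hr => lt_of_smul_mem_add_closedBall hK hρ0 u hr
    have hsub2 : Iio ⟨_, hlo⟩ ⊆
        {r : Ioi (0 : ℝ) | (r : ℝ) • (u : E3) ∈ K + closedBall (0 : E3) ρ} :=
      fun r hr => smul_mem_add_closedBall hK hne hR hKR hρ u r.2 hr
    have hfin : Measure.volumeIoiPow 2 (Iio ⟨_, hup⟩) ≠ ⊤ := by
      rw [Measure.volumeIoiPow_apply_Iio]; exact ENNReal.ofReal_ne_top
    have h1 : m u ≤ (ρ + supportFn K u + 1 / ρ) ^ 3 / 3 := by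
      rw [← volumeIoiPow_real_Iio hup]
      exact measureReal_mono hsub1 hfin
    have h2 : (ρ + supportFn K u - R ^ 2 / ρ) ^ 3 / 3 ≤ m u := by
      rw [← volumeIoiPow_real_Iio hlo]
      exact measureReal_mono hsub2 (measure_ne_top_of_subset hsub1 hfin)
    have hD0 : 0 ≤ D := by positivity
    have h3 := abs_le.1 <| abs_cube_sub_le (d := 1 / ρ) hR.le hD0 hρ1 (hh u) (by
      rw [abs_of_pos (by positivity), div_mul_cancel₀ _ hρ0.ne']
      nlinarith)
    have h4 := abs_le.1 <| abs_cube_sub_le (d := -(R ^ 2 / ρ)) hR.le hD0 hρ1 (hh u) (by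
      rw [abs_neg, abs_of_nonneg (by positivity), hd1]
      linarith)
    rw [← sub_eq_add_neg] at h4
    rw [abs_le]
    constructor <;> linarith [h3.1, h3.2, h4.1, h4.2]
  have hint2 : Integrable (fun u : S2 => (ρ ^ 3 + 3 * ρ ^ 2 * supportFn K u) / 3) sphereMeasure :=
    ((integrable_const _).add (hhint.const_mul _)).div_const _
  have hval : ∫ u : S2, (ρ ^ 3 + 3 * ρ ^ 2 * supportFn K u) / 3 ∂sphereMeasure =
      4 * Real.pi / 3 * ρ ^ 3 + (∫ u : S2, supportFn K u ∂sphereMeasure) * ρ ^ 2 := by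
    rw [integral_div, integral_add (integrable_const _) (hhint.const_mul _), integral_const_mul,
      integral_const, sphereMeasure_real_univ, smul_eq_mul]
    ring
  rw [hvol, ← hval, ← integral_sub hint hint2]
  have h5 := norm_integral_le_of_norm_le_const (μ := sphereMeasure)
    (f := fun u => m u - (ρ ^ 3 + 3 * ρ ^ 2 * supportFn K u) / 3) (ae_of_all _ hbound)
  rw [sphereMeasure_real_univ] at h5
  refine h5.trans_eq ?_
  ring

open Polynomial in
theorem coeff_eq_zero_of_abs_cubic_le {a b c d C : ℝ}
    (h : ∀ᶠ ρ : ℝ in atTop, |a + b * ρ + c * ρ ^ 2 + d * ρ ^ 3| ≤ C * ρ) : c = 0 ∧ d = 0 := by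
  set p : ℝ[X] := Polynomial.C a + Polynomial.C b * X + Polynomial.C c * X ^ 2 +
    Polynomial.C d * X ^ 3 with hp
  -- Keeps the comparison polynomial nonzero whatever C is.
  have hC : (0 : ℝ) < max C 1 := by positivity
  have hdeg : p.natDegree ≤ (Polynomial.C (max C 1) * X : ℝ[X]).natDegree := by
    refine natDegree_le_of_eval_le (mul_ne_zero (C_ne_zero.2 hC.ne') X_ne_zero) ?_
    filter_upwards [h, eventually_ge_atTop 0] with ρ h1 h2
    simp only [hp, eval_add, eval_mul, eval_C, eval_X, eval_pow]
    exact h1.trans (by gcongr; exact le_max_left _ _)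
  rw [natDegree_C_mul_X _ hC.ne'] at hdeg
  have h2 : p.coeff 2 = 0 := coeff_eq_zero_of_natDegree_lt (by omega)
  have h3 : p.coeff 3 = 0 := coeff_eq_zero_of_natDegree_lt (by omega)
  constructor
  · simpa [hp, coeff_X, coeff_C, coeff_X_pow] using h2
  · simpa [hp, coeff_X, coeff_C, coeff_X_pow] using h3

/-- Steiner's formula in space, with Cauchy's formula for the surface area and the mean width
formula for the mean curvature integral. -/
theorem parallelVolume_eq {K : Set E3} (hK : IsCompact K) (hc : Convex ℝ K)
    (hne : K.Nonempty) {ρ : ℝ} (hρ : 0 ≤ ρ) :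
    parallelVolume K ρ = volume.real K +
      ((2 * Real.pi)⁻¹ * ∫ u : S2, segmentGain volume K u ∂sphereMeasure) * ρ +
      (∫ u : S2, supportFn K u ∂sphereMeasure) * ρ ^ 2 + 4 * Real.pi / 3 * ρ ^ 3 := by
  obtain ⟨a, b, hab⟩ := exists_steiner_cubic hK hc hne
  obtain ⟨C, hC⟩ := exists_abs_volume_add_closedBall_sub_le hK hne
  set F := (2 * Real.pi)⁻¹ * ∫ u : S2, segmentGain volume K u ∂sphereMeasure
  set M := ∫ u : S2, supportFn K u ∂sphereMeasure
  -- The exact cubic and the expansion at infinity differ by O(ρ), which forces their top two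
  -- coefficients to agree.
  obtain ⟨ha, hb⟩ := coeff_eq_zero_of_abs_cubic_le (a := volume.real K) (b := F) (c := a - M)
    (d := b - 4 * Real.pi / 3) (C := C) (by
      filter_upwards [hC, eventually_ge_atTop 0] with ρ h1 h2
      rw [hab ρ h2] at h1
      convert h1 using 2
      ring)
  rw [parallelVolume, ← hK.add_closedBall_zero hρ, hab ρ hρ, sub_eq_zero.1 ha,
    sub_eq_zero.1 hb]

theorem tendsto_areaQuotient {K : Set E3} (hK : IsCompact K) (hc : Convex ℝ K)
    (hne : K.Nonempty) : Tendsto (areaQuotient K) (𝓝[>] (0 : ℝ))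
      (𝓝 ((2 * Real.pi)⁻¹ * ∫ u : S2, segmentGain volume K u ∂sphereMeasure)) := by
  set F := (2 * Real.pi)⁻¹ * ∫ u : S2, segmentGain volume K u ∂sphereMeasure with hF
  set M := ∫ u : S2, supportFn K u ∂sphereMeasure with hM
  have h : Tendsto (fun ρ : ℝ => F + M * ρ + 4 * Real.pi / 3 * ρ ^ 2) (𝓝[>] 0) (𝓝 F) := by
    refine tendsto_nhdsWithin_of_tendsto_nhds ?_
    convert (by fun_prop : Continuous fun ρ : ℝ =>
      F + M * ρ + 4 * Real.pi / 3 * ρ ^ 2).tendsto 0 using 2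
    simp
  refine h.congr' ?_
  filter_upwards [self_mem_nhdsWithin] with ρ hρ
  have hρ' : ρ ≠ 0 := ne_of_gt hρ
  rw [areaQuotient, parallelVolume_eq hK hc hne (le_of_lt hρ), ← hF, ← hM]
  field_simp
  ring

theorem surfaceArea_eq {K : Set E3} (hK : IsCompact K) (hc : Convex ℝ K) (hne : K.Nonempty) :
    surfaceArea K = (2 * Real.pi)⁻¹ * ∫ u : S2, segmentGain volume K u ∂sphereMeasure :=
  (tendsto_areaQuotient hK hc hne).limUnder_eq

theorem tendsto_meanCurvatureQuotient {K : Set E3} (hK : IsCompact K) (hc : Convex ℝ K)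
    (hne : K.Nonempty) : Tendsto (meanCurvatureQuotient K) (𝓝[>] (0 : ℝ))
      (𝓝 (∫ u : S2, supportFn K u ∂sphereMeasure)) := by
  set M := ∫ u : S2, supportFn K u ∂sphereMeasure with hM
  have h : Tendsto (fun ρ : ℝ => M + 4 * Real.pi / 3 * ρ) (𝓝[>] 0) (𝓝 M) := by
    refine tendsto_nhdsWithin_of_tendsto_nhds ?_
    convert (by fun_prop : Continuous fun ρ : ℝ => M + 4 * Real.pi / 3 * ρ).tendsto 0 using 2
    simp
  refine h.congr' ?_
  filter_upwards [self_mem_nhdsWithin] with ρ hρ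
  have hρ' : ρ ≠ 0 := ne_of_gt hρ
  rw [meanCurvatureQuotient, parallelVolume_eq hK hc hne (le_of_lt hρ), surfaceArea_eq hK hc hne,
    ← hM]
  field_simp
  ring

theorem meanCurvatureIntegral_eq {K : Set E3} (hK : IsCompact K) (hc : Convex ℝ K)
    (hne : K.Nonempty) :
    meanCurvatureIntegral K = ∫ u : S2, supportFn K u ∂sphereMeasure :=
  (tendsto_meanCurvatureQuotient hK hc hne).limUnder_eq

theorem integral_width_sphere {K : Set E3} (hK : IsCompact K) (hc : Convex ℝ K)
    (hne : K.Nonempty) :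
    ∫ v : S2, (supportFn K v + supportFn K (-v)) ∂sphereMeasure =
      2 * meanCurvatureIntegral K := by
  have h1 : Integrable (fun u : S2 => supportFn K (u : E3)) sphereMeasure :=
    integrable_comp_sphere (continuous_supportFn hK hne)
  have h2 : Integrable (fun u : S2 => supportFn K (-(u : E3))) sphereMeasure :=
    integrable_comp_sphere (g := fun x => supportFn K (-x))
      ((continuous_supportFn hK hne).comp continuous_neg)
  have h3 : ∫ u : S2, supportFn K (-(u : E3)) ∂sphereMeasure =
      ∫ u : S2, supportFn K (u : E3) ∂sphereMeasure :=
    measurePreserving_neg_sphere.integral_comp (Homeomorph.neg S2).measurableEmbedding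
      fun u : S2 => supportFn K (u : E3)
  rw [integral_add h1 h2, h3, meanCurvatureIntegral_eq hK hc hne]
  ring

end MeanWidth

/-! ### Line-plane pairs meeting K and the double count -/

section Incidence

/-- The directions of the lines through `P` that meet `K`. -/
def lineDirections (K : Set E3) (P : E3) : Set S2 := {u | ∃ t : ℝ, P + t • (u : E3) ∈ K}

/-- The normals of the planes through `P` that meet `K`. -/
def planeNormals (K : Set E3) (P : E3) : Set S2 := {v | ∃ k ∈ K, inner ℝ (k - P) (v : E3) = 0}

/-- The pairs of a point and two directions for which the line and the plane through the point
both meet `K`. -/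
def incidenceSet (K : Set E3) : Set (E3 × (S2 × S2)) :=
  {z | z.2.1 ∈ lineDirections K z.1 ∧ z.2.2 ∈ planeNormals K z.1}

/-- The weight `|⟨u, v⟩|` of a pair of directions. -/
noncomputable def inclination (p : S2 × S2) : ENNReal :=
  ENNReal.ofReal |inner ℝ (p.1 : E3) (p.2 : E3)|

/-- The total weight of the line-plane pairs through `P` that meet `K`. -/
noncomputable def pairContent (K : Set E3) (P : E3) : ENNReal :=
  ∫⁻ p in lineDirections K P ×ˢ planeNormals K P, inclination p ∂(sphereMeasure.prod sphereMeasure)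

/-- Projection along a compact factor is a closed map; this supplies the measurability needed for
Fubini. -/
theorem isClosed_exists_mem_of_isCompact {X Y : Type*} [TopologicalSpace X] [TopologicalSpace Y]
    {A : Set Y} (hA : IsCompact A) {C : Set (X × Y)} (hC : IsClosed C) :
    IsClosed {x | ∃ y ∈ A, (x, y) ∈ C} := by
  have : CompactSpace A := isCompact_iff_compactSpace.1 hA
  have h := isClosedMap_fst_of_compactSpace (X := X) (Y := A) _
    (hC.preimage (f := fun z : X × A => (z.1, (z.2 : Y))) (by fun_prop))
  convert h using 1
  ext x
  simp

theorem measurable_inclination : Measurable inclination := by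
  have : Continuous fun p : S2 × S2 => |inner ℝ (p.1 : E3) (p.2 : E3)| := by fun_prop
  exact this.measurable.ennreal_ofReal

theorem measurableSet_solidAngle_graph {K : Set E3} (hK : IsCompact K) :
    MeasurableSet {z : E3 × S2 | z.2 ∈ solidAngle K z.1} := by
  -- Rays are cut to bounded segments to gain compactness in t.
  have h : {z : E3 × S2 | z.2 ∈ solidAngle K z.1} =
      ⋃ n : ℕ, {z : E3 × S2 | ∃ t ∈ Icc (0 : ℝ) n,
        (z, t) ∈ {y : (E3 × S2) × ℝ | y.1.1 + y.2 • (y.1.2 : E3) ∈ K}} := by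
    ext z
    simp only [mem_ofPred_eq, solidAngle, mem_iUnion, mem_Icc]
    constructor
    · rintro ⟨t, ht, h⟩
      obtain ⟨n, hn⟩ := exists_nat_ge t
      exact ⟨n, t, ⟨ht, hn⟩, h⟩
    · rintro ⟨n, t, ⟨ht, -⟩, h⟩
      exact ⟨t, ht, h⟩
  rw [h]
  exact MeasurableSet.iUnion fun n => (isClosed_exists_mem_of_isCompact isCompact_Icc
    (hK.isClosed.preimage (by fun_prop))).measurableSet

theorem measurableSet_planeNormals_graph {K : Set E3} (hK : IsCompact K) :
    MeasurableSet {z : E3 × S2 | z.2 ∈ planeNormals K z.1} :=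
  (isClosed_exists_mem_of_isCompact hK
    (C := {y : (E3 × S2) × E3 | inner ℝ (y.2 - y.1.1) (y.1.2 : E3) = 0})
    (isClosed_eq (by fun_prop) continuous_const)).measurableSet

theorem lineDirections_eq_union (K : Set E3) (P : E3) :
    lineDirections K P = solidAngle K P ∪ (fun u => -u) ⁻¹' solidAngle K P := by
  ext u
  simp only [lineDirections, solidAngle, mem_union, mem_preimage, mem_ofPred_eq]
  constructor
  · rintro ⟨t, ht⟩
    rcases le_total 0 t with h | h
    · exact Or.inl ⟨t, h, ht⟩
    · exact Or.inr ⟨-t, by linarith, by simpa using ht⟩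
  · rintro (⟨t, -, ht⟩ | ⟨t, -, ht⟩)
    · exact ⟨t, ht⟩
    · exact ⟨-t, by simpa using ht⟩

/-- If both opposite rays met K, P would lie between two points of K. -/
theorem disjoint_solidAngle_neg {K : Set E3} (hc : Convex ℝ K) {P : E3} (hP : P ∉ K) :
    Disjoint (solidAngle K P) ((fun u => -u) ⁻¹' solidAngle K P) := by
  rw [Set.disjoint_left]
  rintro u ⟨s, hs, h1⟩ ⟨t, ht, h2⟩
  rcases hs.eq_or_lt with rfl | hs
  · exact hP (by simpa using h1)
  apply hP
  have hst : 0 < s + t := by linarith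
  have := hc h1 h2 (a := t / (s + t)) (b := s / (s + t)) (by positivity) (by positivity)
    (by rw [← add_div, add_comm, div_self hst.ne'])
  convert this using 1
  have e1 : t / (s + t) + s / (s + t) = 1 := by rw [← add_div, add_comm, div_self hst.ne']
  have e2 : t / (s + t) * s - s / (s + t) * t = 0 := by ring
  have hneg : ((-u : S2) : E3) = -(u : E3) := rfl
  calc P = (t / (s + t) + s / (s + t)) • P + (t / (s + t) * s - s / (s + t) * t) • (u : E3) := by
        rw [e1, e2]; simp
    _ = _ := by
        simp only [hneg]
        module

/-- Since P ∉ K, any k ∈ K on the plane differs from P, and k − P can be normalized to a direction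
in Ω. -/
theorem normalsMeeting_solidAngle {K : Set E3} {P : E3} (hP : P ∉ K) :
    normalsMeeting (solidAngle K P) = planeNormals K P := by
  ext v
  simp only [normalsMeeting, solidAngle, planeNormals, mem_ofPred_eq]
  constructor
  · rintro ⟨u, ⟨t, -, ht⟩, huv⟩
    exact ⟨_, ht, by rw [add_sub_cancel_left, inner_smul_left, huv, mul_zero]⟩
  · rintro ⟨k, hk, hkv⟩
    have hne : ‖k - P‖ ≠ 0 := norm_ne_zero_iff.2 (sub_ne_zero.2 fun h => hP (h ▸ hk))
    refine ⟨⟨‖k - P‖⁻¹ • (k - P), ?_⟩, ⟨‖k - P‖, norm_nonneg _, ?_⟩, ?_⟩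
    · simp [norm_smul, inv_mul_cancel₀ hne]
    · simpa [smul_smul, mul_inv_cancel₀ hne] using hk
    · simp only [inner_smul_left, hkv, mul_zero]

theorem measurableSet_incidenceSet {K : Set E3} (hK : IsCompact K) :
    MeasurableSet (incidenceSet K) := by
  have h1 : Measurable fun z : E3 × (S2 × S2) => (z.1, z.2.1) := by fun_prop
  have h2 : Measurable fun z : E3 × (S2 × S2) => (z.1, z.2.2) := by fun_prop
  have h3 : Measurable fun z : E3 × (S2 × S2) => (z.1, -z.2.1) :=
    (by fun_prop : Continuous fun z : E3 × (S2 × S2) => (z.1, -z.2.1)).measurable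
  have h := ((h1 (measurableSet_solidAngle_graph hK)).union
    (h3 (measurableSet_solidAngle_graph hK))).inter (h2 (measurableSet_planeNormals_graph hK))
  convert h using 1
  ext z
  simp only [incidenceSet, lineDirections_eq_union, mem_inter_iff, mem_union, mem_preimage,
    mem_ofPred_eq]

theorem measurable_indicator_incidenceSet {K : Set E3} (hK : IsCompact K) :
    Measurable ((incidenceSet K).indicator fun z => inclination z.2) :=
  (measurable_inclination.comp measurable_snd).indicator (measurableSet_incidenceSet hK)

theorem pairContent_eq_lintegral_indicator {K : Set E3} (hK : IsCompact K) (P : E3) :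
    pairContent K P = ∫⁻ p, (incidenceSet K).indicator (fun z => inclination z.2) (P, p)
      ∂(sphereMeasure.prod sphereMeasure) := by
  have hm : MeasurableSet (lineDirections K P ×ˢ planeNormals K P) :=
    measurable_prodMk_left (x := P) (measurableSet_incidenceSet hK)
  rw [pairContent, ← lintegral_indicator hm]
  rfl

theorem measurable_pairContent {K : Set E3} (hK : IsCompact K) : Measurable (pairContent K) := by
  rw [funext fun P => pairContent_eq_lintegral_indicator hK P]
  exact (measurable_indicator_incidenceSet hK).lintegral_prod_right'

theorem alpha_eq_toReal (Ω : Set S2) : alpha Ω = (1 / 2) *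
    (∫⁻ p in Ω ×ˢ normalsMeeting Ω, inclination p ∂(sphereMeasure.prod sphereMeasure)).toReal := by
  rw [alpha, integral_eq_lintegral_of_nonneg_ae (ae_of_all _ fun p => abs_nonneg _)
    (by fun_prop : Continuous fun p : S2 × S2 =>
      |inner ℝ (p.1 : E3) (p.2 : E3)|).aestronglyMeasurable]
  rfl

/-- One factor 2 comes from the antipodal rays of each line, the other from the ½ in `alpha`. -/
theorem pairContent_toReal {K : Set E3} (hK : IsCompact K) (hc : Convex ℝ K) {P : E3}
    (hP : P ∉ K) : (pairContent K P).toReal = 4 * alpha (solidAngle K P) := by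
  have hΩ : MeasurableSet (solidAngle K P) :=
    measurable_prodMk_left (x := P) (measurableSet_solidAngle_graph hK)
  have hN : MeasurableSet (planeNormals K P) :=
    measurable_prodMk_left (x := P) (measurableSet_planeNormals_graph hK)
  have hneg : MeasurableSet ((fun u : S2 => -u) ⁻¹' solidAngle K P) :=
    measurePreserving_neg_sphere.measurable hΩ
  rw [alpha_eq_toReal, normalsMeeting_solidAngle hP, pairContent, lineDirections_eq_union,
    union_prod, lintegral_union (hneg.prod hN)
      (Disjoint.set_prod_left (disjoint_solidAngle_neg hc hP) _ _)]
  have hsym : ∫⁻ p in ((fun u : S2 => -u) ⁻¹' solidAngle K P) ×ˢ planeNormals K P, inclination p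
        ∂(sphereMeasure.prod sphereMeasure) =
      ∫⁻ p in solidAngle K P ×ˢ planeNormals K P, inclination p
        ∂(sphereMeasure.prod sphereMeasure) := by
    have hmp : MeasurePreserving (Prod.map (fun u : S2 => -u) (id : S2 → S2))
        (sphereMeasure.prod sphereMeasure) (sphereMeasure.prod sphereMeasure) :=
      measurePreserving_neg_sphere.prod (MeasurePreserving.id _)
    rw [← hmp.setLIntegral_comp_preimage (hΩ.prod hN) measurable_inclination]
    refine lintegral_congr fun p => ?_
    simp [inclination]
  rw [hsym, ← two_mul, ENNReal.toReal_mul]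
  simp
  ring

theorem lintegral_inclination (u : S2) :
    ∫⁻ v, inclination (u, v) ∂sphereMeasure = ENNReal.ofReal (2 * Real.pi) := by
  have h := integral_abs_inner_sphere (u : E3)
  rw [norm_eq_of_mem_sphere, mul_one] at h
  rw [← h, ofReal_integral_eq_lintegral_ofReal
    (integrable_comp_sphere (g := fun x => |inner ℝ x (u : E3)|) (by fun_prop))
    (ae_of_all _ fun _ => abs_nonneg _)]
  refine lintegral_congr fun v => ?_
  rw [inclination, real_inner_comm]

theorem sphereMeasure_univ : sphereMeasure univ = ENNReal.ofReal (4 * Real.pi) := by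
  rw [← sphereMeasure_real_univ, ofReal_measureReal]

theorem pairContent_of_mem {K : Set E3} {P : E3} (hP : P ∈ K) :
    pairContent K P = ENNReal.ofReal (8 * Real.pi ^ 2) := by
  have h1 : lineDirections K P = univ := eq_univ_of_forall fun u => ⟨0, by simpa using hP⟩
  have h2 : planeNormals K P = univ := eq_univ_of_forall fun v => ⟨P, hP, by simp⟩
  rw [pairContent, h1, h2, univ_prod_univ, Measure.restrict_univ,
    lintegral_prod _ measurable_inclination.aemeasurable]
  simp_rw [lintegral_inclination]
  rw [lintegral_const, sphereMeasure_univ, ← ENNReal.ofReal_mul (by positivity)]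
  congr 1
  ring

/-- Integrating over P first leaves projection area times width, a product of a function of u and
one of v; the orthogonal pairs excluded are null. -/
theorem lintegral_pairContent {K : Set E3} (hK : IsCompact K) (hc : Convex ℝ K)
    (hne : K.Nonempty) : ∫⁻ P, pairContent K P =
      ENNReal.ofReal (2 * Real.pi * meanCurvatureIntegral K * surfaceArea K) := by
  set g : S2 → ℝ := fun u => segmentGain volume K u / 2 with hg
  set w : S2 → ℝ := fun v => supportFn K v + supportFn K (-v) with hw
  have hg0 : ∀ u, 0 ≤ g u := fun u => by
    have := segmentGain_nonneg volume hK hc hne (u : E3)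
    positivity
  have hw0 : ∀ v, 0 ≤ w v := fun v => width_nonneg hK hne (v : E3)
  have hgc : Continuous fun x : E3 => segmentGain volume K x / 2 :=
    (continuous_segmentGain volume hK hc hne).div_const 2
  have hwc : Continuous fun x : E3 => supportFn K x + supportFn K (-x) :=
    (continuous_supportFn hK hne).add ((continuous_supportFn hK hne).comp continuous_neg)
  have hgi : Integrable g sphereMeasure := integrable_comp_sphere hgc
  have hwi : Integrable w sphereMeasure := integrable_comp_sphere hwc
  have hgm : Measurable g := (hgc.comp continuous_subtype_val).measurable
  have hwm : Measurable w := (hwc.comp continuous_subtype_val).measurable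
  have hfib : ∀ u v : S2, inner ℝ (u : E3) (v : E3) ≠ 0 →
      ∫⁻ P, (incidenceSet K).indicator (fun z => inclination z.2) (P, (u, v)) =
        ENNReal.ofReal (g u) * ENNReal.ofReal (w v) := by
    intro u v huv
    obtain ⟨b, hb0, hb, hvol⟩ := exists_projection_content volume hK hc hne huv
    have hbg : b = g u := by
      have h1 := hb 1 zero_le_one
      rw [one_smul] at h1
      simp only [hg, segmentGain, h1]
      ring
    have hm : MeasurableSet {P : E3 | (∃ t : ℝ, P + t • (u : E3) ∈ K) ∧
        ∃ k ∈ K, inner ℝ (k - P) (v : E3) = 0} :=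
      measurable_prodMk_right (y := (u, v)) (measurableSet_incidenceSet hK)
    rw [mul_comm, ← ENNReal.ofReal_mul (hw0 v), ← hbg, ← hvol,
      ← lintegral_indicator_const hm]
    rfl
  simp_rw [pairContent_eq_lintegral_indicator hK]
  rw [lintegral_lintegral_swap
      (f := fun P p => (incidenceSet K).indicator (fun z => inclination z.2) (P, p))
      (measurable_indicator_incidenceSet hK).aemeasurable,
    lintegral_prod _ (measurable_indicator_incidenceSet hK).lintegral_prod_left'.aemeasurable]
  have hinner : ∀ u : S2, ∫⁻ v, ∫⁻ P,
      (incidenceSet K).indicator (fun z => inclination z.2) (P, (u, v)) ∂volume ∂sphereMeasure =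
      ENNReal.ofReal (g u) * ENNReal.ofReal (2 * meanCurvatureIntegral K) := by
    intro u
    have hu : (u : E3) ≠ 0 := ne_zero_of_mem_unit_sphere u
    calc _ = ∫⁻ v, ENNReal.ofReal (g u) * ENNReal.ofReal (w v) ∂sphereMeasure := by
          refine lintegral_congr_ae ?_
          filter_upwards [ae_inner_ne_zero_sphere hu] with v hv
          exact hfib u v (by rwa [real_inner_comm])
      _ = _ := by
          rw [lintegral_const_mul _ hwm.ennreal_ofReal,
            ← ofReal_integral_eq_lintegral_ofReal hwi (ae_of_all _ hw0),
            integral_width_sphere hK hc hne]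
  simp_rw [hinner]
  have hM : 0 ≤ 2 * meanCurvatureIntegral K := by
    rw [← integral_width_sphere hK hc hne]
    exact integral_nonneg hw0
  -- Cauchy's formula: the gains integrate to 2πF, and g is half the gain.
  have hF : ∫ u, g u ∂sphereMeasure = Real.pi * surfaceArea K := by
    rw [hg, integral_div, surfaceArea_eq hK hc hne]
    field_simp
  rw [lintegral_mul_const _ hgm.ennreal_ofReal,
    ← ofReal_integral_eq_lintegral_ofReal hgi (ae_of_all _ hg0), hF, mul_comm,
    ← ENNReal.ofReal_mul hM]
  congr 1
  ring

end Incidence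

/-! ### The integral formula -/

theorem theorem1p1 (K : Set E3) (hK : IsCompact K) (hconv : Convex ℝ K) :
    -- the limits that define the surface area and the mean curvature integral exist
    Tendsto (areaQuotient K) (𝓝[>] (0 : ℝ)) (𝓝 (surfaceArea K)) ∧
    Tendsto (meanCurvatureQuotient K) (𝓝[>] (0 : ℝ)) (𝓝 (meanCurvatureIntegral K)) ∧
    -- the integral over the exterior of `K` converges
    IntegrableOn (fun P : E3 => alpha (solidAngle K P)) Kᶜ volume ∧
    (Real.pi / 2) * meanCurvatureIntegral K * surfaceArea K
        - 2 * Real.pi ^ 2 * (volume : Measure E3).real K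
      = ∫ P in Kᶜ, alpha (solidAngle K P) := by
  rcases K.eq_empty_or_nonempty with rfl | hne
  -- Steiner's formula fails for the empty set, but every quantity in the claim vanishes.
  · have h1 : areaQuotient ∅ = fun _ => 0 := by
      ext ρ; simp [areaQuotient, parallelVolume]
    have h2 : surfaceArea ∅ = 0 := by
      rw [surfaceArea, h1]; exact tendsto_const_nhds.limUnder_eq
    have h3 : meanCurvatureQuotient ∅ = fun _ => 0 := by
      ext ρ; simp [meanCurvatureQuotient, parallelVolume, h2]
    have h4 : meanCurvatureIntegral ∅ = 0 := by
      rw [meanCurvatureIntegral, h3]; exact tendsto_const_nhds.limUnder_eq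
    have h5 : ∀ P : E3, alpha (solidAngle ∅ P) = 0 := fun P => by
      simp [solidAngle, alpha]
    simp [h1, h2, h3, h4, h5]
  · refine ⟨surfaceArea_eq hK hconv hne ▸ tendsto_areaQuotient hK hconv hne,
      meanCurvatureIntegral_eq hK hconv hne ▸ tendsto_meanCurvatureQuotient hK hconv hne, ?_⟩
    have htot := lintegral_pairContent hK hconv hne
    have hsplit := lintegral_add_compl (pairContent K) hK.measurableSet (μ := volume)
    have hin : ∫⁻ P in K, pairContent K P = ENNReal.ofReal (8 * Real.pi ^ 2) * volume K := by
      rw [setLIntegral_congr_fun hK.measurableSet fun P hP => pairContent_of_mem hP,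
        setLIntegral_const]
    have hfin : ∫⁻ P in Kᶜ, pairContent K P ≠ ⊤ := by
      refine ne_top_of_le_ne_top (b := ∫⁻ P, pairContent K P) ?_ (setLIntegral_le_lintegral _ _)
      rw [htot]
      exact ENNReal.ofReal_ne_top
    have hmeas : AEMeasurable (pairContent K) (volume.restrict Kᶜ) :=
      (measurable_pairContent hK).aemeasurable
    have halpha : ∀ P ∈ Kᶜ, alpha (solidAngle K P) = (1 / 4) * (pairContent K P).toReal :=
      fun P hP => by rw [pairContent_toReal hK hconv hP]; ring
    have hint : IntegrableOn (fun P => (pairContent K P).toReal) Kᶜ volume :=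
      integrable_toReal_of_lintegral_ne_top hmeas hfin
    refine ⟨IntegrableOn.congr_fun (hint.const_mul (1 / 4)) (fun P hP => (halpha P hP).symm)
      hK.measurableSet.compl, ?_⟩
    rw [setIntegral_congr_fun hK.measurableSet.compl halpha, integral_const_mul,
      integral_toReal hmeas (ae_lt_top' hmeas hfin)]
    have hnonneg : 0 ≤ 2 * Real.pi * meanCurvatureIntegral K * surfaceArea K := by
      have hM : 0 ≤ meanCurvatureIntegral K := by
        have := integral_width_sphere hK hconv hne
        have h0 : 0 ≤ ∫ v : S2, (supportFn K v + supportFn K (-v)) ∂sphereMeasure :=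
          integral_nonneg fun v => width_nonneg hK hne (v : E3)
        linarith
      have hF : 0 ≤ surfaceArea K := by
        rw [surfaceArea_eq hK hconv hne]
        have : 0 ≤ ∫ u : S2, segmentGain volume K u ∂sphereMeasure :=
          integral_nonneg fun u => segmentGain_nonneg volume hK hconv hne (u : E3)
        positivity
      positivity
    -- The double count in real numbers: 8π²V plus the exterior content equals 2πMF; dividing by 4
    -- gives the claim.
    have hreal := congrArg ENNReal.toReal hsplit
    rw [htot, hin, ENNReal.toReal_add (ENNReal.mul_ne_top ENNReal.ofReal_ne_top
      hK.measure_lt_top.ne) hfin, ENNReal.toReal_ofReal hnonneg, ENNReal.toReal_mul,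
      ENNReal.toReal_ofReal (by positivity), ← Measure.real] at hreal
    linarith
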